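/- Let $H:\mathbb R\to[0,1]$ be a low pass filter, i.e. $H$ is infinitely differentiable and even, $H(t)=1$ for $|t|\le 1/2$, and $H(t)=0$ for $|t|\ge 1$. Put $\hbar_n=\bigl(\sum_{|\ell|<n}H(|\ell|/n)\bigr)^{-1}$ and, for $F:\mathbb R\to\mathbb C$, $R>0$, $t^*\in\mathbb R$, $$\mathcal T_{n,R}(F)(t^*;x)=\hbar_n\sum_{|\ell|<n}H(|\ell|/n)\,F(t^*-\ell/R)\,e^{i\ell x},\qquad x\in\mathbb T=\mathbb R/2\pi\mathbb Z .$$ For $x,y\in\mathbb T$ let $|x-y|$ denote the distance on $\mathbb T$, that is, $\min_{k\in\mathbb Z}|x-y-2\pi k|$. A mean zero real random variable $X$ is in $\mathcal G(\nu)$ if $\log\mathbb E\,e^{sX}\le (s\nu)^2/2$ for all $s\in\mathbb R$; a complex random variable is in $\mathcal G(\nu)$ if its real and imaginary parts are. **Theorem.** There are positive constants $C_1\ge 1$, $C_2$, $C_3$ depending only on $H$ such that the following holds. Let $S\ge 2$ and $K\ge 1$ be integers, $0<\delta<1$, $t^*\in\mathbb R$, $\alpha,\Delta,R>0$, $V\ge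 0$, and let $n=\lfloor R\Delta\rfloor$. For $j=1,\dots,K$ let $A_j$ (complex valued) be continuous and $\phi_j$ (real valued) be continuously differentiable on $[t^*-\Delta,t^*+\Delta]$, with $$|A_j(t^*+u)-A_j(t^*)|\le\alpha|u|\,|A_j(t^*)|,\qquad |\phi_j'(t^*+u)-\phi_j'(t^*)|\le\alpha|u|\,|\phi_j'(t^*)|,\qquad |u|\le\Delta .$$ Let $f_j=A_je^{i\phi_j}$ and $F(t)=\sum_{j=1}^K f_j(t)+\epsilon(t)$, where each $\epsilon(t)$ is a complex random variable in $\mathcal G(V)$ and the samples $\epsilon(t^*-\ell/R)$, $|\ell|<n$, are independent. Write $$\mathbf M=\sum_j|A_j(t^*)|,\quad B=\max_j|\phi_j'(t^*)|,\quad \mathfrak m=\min_j|f_j(t^*)|,\quad \lambda_j=\phi_j'(t^*)/R \in\mathbb T,\quad \eta^*=\min_{j\ne k}|\lambda_j-\lambda_k|$$ ($\eta^*=\infty$ if $K=1$), and $$L=\frac{14\sqrt{2\pi}}{3}\,\frac{\|H^{(S)}\|_1}{\|H\|_1},\qquad C=\max\Bigl(1,\Bigl(\frac{16\,\mathbf M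 L}{\mathfrak m}\Bigr)^{1/S}\Bigr).$$ Assume that $\mathfrak m>0$, $\eta^*>0$, and $$n\ge C_1,\qquad C_2V\sqrt{\frac{\log(C_3n/\delta)}{n}}\le\frac{\mathfrak m}{16},\qquad n\ge\frac{4C}{\eta^*},\qquad \alpha\mathbf M(B\Delta+1)\Delta\le\frac{\mathfrak m}{4}.$$ Let $\mathbb G=\{x\in\mathbb T:|\mathcal T_{n,R}(F)(t^*;x)|\ge 3\mathfrak m/4\}$. Then with probability exceeding $1-\delta$ all of the following hold: * $\mathbb G$ is a disjoint union of $K$ sets $\mathbb G_1,\dots,\mathbb G_K$; * $\operatorname{diam}(\mathbb G_\ell)\le 2C/n$ for each $\ell$; * $\operatorname{dist}(\mathbb G_\ell,\mathbb G_k)\ge\eta^*/2$ for $\ell\ne k$; * $\{x\in\mathbb T:|x-\lambda_\ell|\le 1/(4n)\}\subseteq\mathbb G_\ell$ for each $\ell$ (in particular $\mathbb G_\ell\neq\emptyset$); * for each $\ell$ the function $|\mathcal T_{n,R}(F)(t^*;\cdot)|$ attains its maximum over $\mathbb G_\ell$, and every maximizer $\hat\lambda_\ell\in\mathbb G_\ell$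 satisfies $|\hat\lambda_\ell-\lambda_\ell|\le 2C/n$; consequently, for a suitable real representative of $\hat\lambda_\ell$ modulo $2\pi$, $|R\hat\lambda_\ell-\phi_\ell'(t^*)|\le 2CR/n$. -/

import Mathlib

namespace SSO

open MeasureTheory ProbabilityTheory
open scoped ENNReal

noncomputable section

/-- The circle `ℝ / 2πℤ`; its norm `‖x‖` is the distance from `x` to the nearest multiple of `2π`. -/
abbrev Torus : Type := AddCircle (2 * Real.pi)

/-- A (smooth) low pass filter. -/
structure IsLowPassFilter (H : ℝ → ℝ) : Prop where
  smooth : ContDiff ℝ (⊤ : ℕ∞) H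
  mem_Icc : ∀ t, H t ∈ Set.Icc (0 : ℝ) 1
  even : ∀ t, H (-t) = H t
  eq_one : ∀ t, |t| ≤ 1 / 2 → H t = 1
  eq_zero : ∀ t, 1 ≤ |t| → H t = 0

/-- The normalizing constant `ħ_n = (∑_{|ℓ| < n} H(|ℓ| / n))⁻¹`. -/
def hbar (H : ℝ → ℝ) (n : ℕ) : ℝ :=
  (∑ ℓ ∈ Finset.Ioo (-(n : ℤ)) n, H (|(ℓ : ℝ)| / n))⁻¹

/-- The signal separation operator
`T_{n,R}(F)(t; x) = ħ_n ∑_{|ℓ| < n} H(|ℓ| / n) F(t - ℓ / R) exp(i ℓ x)`.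
On the circle of length `2π`, Mathlib's `fourier ℓ x` is `exp(i ℓ x)`. -/
def sepOp (H : ℝ → ℝ) (n : ℕ) (R : ℝ) (F : ℝ → ℂ) (t : ℝ) (x : Torus) : ℂ :=
  (hbar H n : ℂ) * ∑ ℓ ∈ Finset.Ioo (-(n : ℤ)) n,
    (H (|(ℓ : ℝ)| / n) : ℂ) * F (t - (ℓ : ℝ) / R) * fourier ℓ x

/-- The class `𝒢(ν)` of real valued random variables: mean zero and
`log 𝔼 exp(s X) ≤ (s ν)² / 2` for every real `s` (the expectation being finite). -/
structure IsSubGaussian {Ω : Type*} [MeasurableSpace Ω] (X : Ω → ℝ) (ν : ℝ) (P : Measure Ω) :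
    Prop where
  mean_zero : ∫ ω, X ω ∂P = 0
  integrable_exp : ∀ s : ℝ, Integrable (fun ω => Real.exp (s * X ω)) P
  log_mgf_le : ∀ s : ℝ, Real.log (∫ ω, Real.exp (s * X ω) ∂P) ≤ (s * ν) ^ 2 / 2

/-- A complex random variable is in `𝒢(ν)` if its real and imaginary parts are. -/
def IsComplexSubGaussian {Ω : Type*} [MeasurableSpace Ω] (X : Ω → ℂ) (ν : ℝ) (P : Measure Ω) :
    Prop :=
  IsSubGaussian (fun ω => (X ω).re) ν P ∧ IsSubGaussian (fun ω => (X ω).im) ν P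

/-- The constant `L = (14 √(2π) / 3) ‖H^{(S)}‖₁ / ‖H‖₁` of the localization estimate. -/
def locConst (H : ℝ → ℝ) (S : ℕ) : ℝ :=
  14 * Real.sqrt (2 * Real.pi) / 3 * ((∫ t, |iteratedDeriv S H t|) / ∫ t, |H t|)

section Signal

variable {K : ℕ}

/-- The component `f_j(s) = A_j(s) exp(i φ_j(s))`. -/
def component (A : Fin K → ℝ → ℂ) (φ : Fin K → ℝ → ℝ) (j : Fin K) (s : ℝ) : ℂ :=
  A j s * Complex.exp (Complex.I * (φ j s : ℂ))

/-- The total amplitude `𝐌 = ∑_j |A_j(t)|`. -/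
def totalAmp (A : Fin K → ℝ → ℂ) (t : ℝ) : ℝ := ∑ j, ‖A j t‖

/-- The minimal amplitude `𝔪 = min_j |f_j(t)|`. -/
def minAmp (A : Fin K → ℝ → ℂ) (φ : Fin K → ℝ → ℝ) (t : ℝ) : ℝ := ⨅ j, ‖component A φ j t‖

/-- The maximal instantaneous frequency `B = max_j |φ_j'(t)|`; `φ'` lists the derivatives. -/
def maxFreq (φ' : Fin K → ℝ → ℝ) (t : ℝ) : ℝ := ⨆ j, |φ' j t|

/-- The reduced frequency `λ_j = φ_j'(t) / R`, as a point of the circle. -/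
def redFreq (φ' : Fin K → ℝ → ℝ) (R t : ℝ) (j : Fin K) : Torus := ((φ' j t / R : ℝ) : Torus)

/-- The minimal separation `η*` of the reduced frequencies on the circle.  It is `∞` when there is
only one component, and `0` when two reduced frequencies coincide on the circle. -/
def minSep (φ' : Fin K → ℝ → ℝ) (R t : ℝ) : ℝ≥0∞ :=
  ⨅ (j : Fin K) (k : Fin K) (_ : j ≠ k), edist (redFreq φ' R t j) (redFreq φ' R t k)

/-- The constant `C = max(1, (16 𝐌 L / 𝔪)^{1/S})`. -/
def clusterConst (H : ℝ → ℝ) (S : ℕ) (A : Fin K → ℝ → ℂ) (φ : Fin K → ℝ → ℝ) (t : ℝ) : ℝ :=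
  max 1 ((16 * totalAmp A t * locConst H S / minAmp A φ t) ^ (1 / (S : ℝ)))

/-- The noisy signal `F(s) = ∑_j f_j(s) + ε(s)` for a realization `ε` of the noise. -/
def noisySignal (A : Fin K → ℝ → ℂ) (φ : Fin K → ℝ → ℝ) (ε : ℝ → ℂ) (s : ℝ) : ℂ :=
  (∑ j, component A φ j s) + ε s

end Signal

/-- The level set `{x ∈ 𝕋 : |T_{n,R}(F)(t; x)| ≥ θ}`. -/
def levelSet (H : ℝ → ℝ) (n : ℕ) (R : ℝ) (F : ℝ → ℂ) (t θ : ℝ) : Set Torus :=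
  {x | θ ≤ ‖sepOp H n R F t x‖}

end

end SSO

namespace SSO

open MeasureTheory ProbabilityTheory
open scoped ENNReal

/-! ### Characters and distances on the circle. -/

section

/-! The operator maps a pure exponential to a translate of the kernel `Φ_n` (`filterKernel`).
Freezing the amplitudes and the frequencies at `t` therefore writes `T(F)(x)` as `∑ f_j(t) Φ_n(x -
λ_j)` plus transformed noise plus a linearization error.

The linearization error is at most `𝔪/8`: the slow variation hypothesis gives `𝔪/4` at the ends of
the window, and the filter-weighted mean of `|ℓ|/n` is at most `1/2`
(`norm_sepOp_noisySignal_sub_le`). The noise is at most `𝔪/16` for all `x` at once, with probability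
above `1 - δ`: sub-Gaussian tails on a grid of `n²` points, then a Lipschitz bound between grid
points (`exists_event_norm_sepOp_noise_le`). So `T(F)` stays within `3𝔪/16` of the kernel sum.

Poisson summation gives `|Φ_n(x)| ≤ L/(n|x|)^S`, while `|Φ_n| ≥ 31/32` on `|x| ≤ 1/(4n)`. The
constant `C` is such that `𝐌L/C^S ≤ 𝔪/16`. If `x` is at least `C/n` away from every `λ_j`, then
`|T(F)(x)| ≤ 𝔪/16 + 3𝔪/16 < 3𝔪/4`. If `x` is within `1/(4n)` of `λ_ℓ`, the other terms add up to at
most `𝔪/64`, and `|T(F)(x)| ≥ (31/32 - 1/64 - 3/16)𝔪 = 49𝔪/64 > 3𝔪/4`. Hence the level set lies in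
the balls of radius `C/n` about the `λ_j`, whose centres are at least `4C/n` apart; the geometric
claims follow (`exists_clusters`). -/

theorem fourier_coe_eq_exp (ℓ : ℤ) (x : ℝ) :
    fourier ℓ (x : Torus) = Complex.exp ((ℓ * x : ℝ) * Complex.I) := by
  rw [fourier_coe_apply]
  congr 1
  have : (Real.pi : ℂ) ≠ 0 := by exact_mod_cast Real.pi_ne_zero
  push_cast
  field_simp

theorem norm_fourier_apply (ℓ : ℤ) (x : Torus) : ‖fourier ℓ x‖ = 1 := Circle.norm_coe _

theorem fourier_apply_sub (ℓ : ℤ) (x y : Torus) :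
    fourier ℓ (x - y) = fourier ℓ x * fourier (-ℓ) y := by
  rw [fourier_apply, zsmul_sub, sub_eq_add_neg, AddCircle.toCircle_add, Circle.coe_mul,
    fourier_apply, fourier_apply, neg_zsmul]

theorem exists_coe_eq_abs_eq_norm (x : Torus) : ∃ y : ℝ, (y : Torus) = x ∧ |y| = ‖x‖ := by
  induction x using QuotientAddGroup.induction_on with
  | H x =>
    refine ⟨x - round ((2 * Real.pi)⁻¹ * x) * (2 * Real.pi), ?_, (AddCircle.norm_eq _).symm⟩
    have h := AddCircle.coe_period (2 * Real.pi)
    have : ((round ((2 * Real.pi)⁻¹ * x) * (2 * Real.pi) : ℝ) : Torus) = 0 := by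
      rw [← zsmul_eq_mul, AddCircle.coe_zsmul, h, smul_zero]
    rw [AddCircle.coe_sub, this, sub_zero]

theorem norm_le_pi (x : Torus) : ‖x‖ ≤ Real.pi := by
  have h := AddCircle.norm_le_half_period (2 * Real.pi) (x := x) (by positivity)
  rw [abs_of_pos (by positivity)] at h
  linarith

/-! ### Sums of the filter over the integers -/

theorem sum_abs_Ioo (n : ℕ) (hn : 1 ≤ n) :
    ∑ ℓ ∈ Finset.Ioo (-(n : ℤ)) n, |ℓ| = n * (n - 1) := by
  induction n, hn using Nat.le_induction with
  | base => decide
  | succ n hn ih =>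
    have hset : Finset.Ioo (-((n + 1 : ℕ) : ℤ)) ((n + 1 : ℕ) : ℤ)
        = insert (n : ℤ) (insert (-(n : ℤ)) (Finset.Ioo (-(n : ℤ)) n)) := by
      ext ℓ
      simp only [Finset.mem_Ioo, Finset.mem_insert]
      omega
    rw [hset, Finset.sum_insert, Finset.sum_insert, ih]
    · simp only [abs_neg, Nat.abs_cast]
      push_cast
      ring
    · simp
    · simp only [Finset.mem_insert, Finset.mem_Ioo]
      omega

theorem card_Ioo_neg (n : ℕ) (hn : 1 ≤ n) :
    ((Finset.Ioo (-(n : ℤ)) n).card : ℝ) = 2 * n - 1 := by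
  rw [Int.card_Ioo]
  have : ((n : ℤ) - -(n : ℤ) - 1).toNat = 2 * n - 1 := by omega
  rw [this, Nat.cast_sub (by omega)]
  push_cast
  ring

theorem mem_Ioo_iff_abs_lt {n : ℕ} {ℓ : ℤ} : ℓ ∈ Finset.Ioo (-(n : ℤ)) n ↔ |ℓ| < (n : ℤ) := by
  rw [Finset.mem_Ioo, abs_lt]

namespace IsLowPassFilter

variable {H : ℝ → ℝ}

theorem nonneg (hH : IsLowPassFilter H) (t : ℝ) : 0 ≤ H t := (hH.mem_Icc t).1

theorem le_one (hH : IsLowPassFilter H) (t : ℝ) : H t ≤ 1 := (hH.mem_Icc t).2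

theorem apply_abs (hH : IsLowPassFilter H) (t : ℝ) : H |t| = H t := by
  rcases abs_choice t with h | h <;> rw [h]
  exact hH.even t

/-- The filter equals `1` at the `2⌊n/2⌋ + 1 ≥ n` integers with `|ℓ| ≤ n/2`. -/
theorem le_sum (hH : IsLowPassFilter H) {n : ℕ} (hn : 1 ≤ n) :
    (n : ℝ) ≤ ∑ ℓ ∈ Finset.Ioo (-(n : ℤ)) n, H (|(ℓ : ℝ)| / n) := by
  have hn0 : (0 : ℝ) < n := by exact_mod_cast hn
  have hsub : Finset.Icc (-((n / 2 : ℕ) : ℤ)) ((n / 2 : ℕ) : ℤ) ⊆ Finset.Ioo (-(n : ℤ)) n := by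
    intro ℓ
    simp only [Finset.mem_Icc, Finset.mem_Ioo]
    omega
  calc (n : ℝ) ≤ ∑ ℓ ∈ Finset.Icc (-((n / 2 : ℕ) : ℤ)) ((n / 2 : ℕ) : ℤ), (1 : ℝ) := by
        rw [Finset.sum_const, nsmul_eq_mul, mul_one, Int.card_Icc]
        exact_mod_cast (by omega)
    _ = ∑ ℓ ∈ Finset.Icc (-((n / 2 : ℕ) : ℤ)) ((n / 2 : ℕ) : ℤ), H (|(ℓ : ℝ)| / n) := by
        refine Finset.sum_congr rfl fun ℓ hℓ => (hH.eq_one _ ?_).symm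
        rw [abs_of_nonneg (by positivity), div_le_div_iff₀ hn0 two_pos]
        have : |ℓ| * 2 ≤ 1 * (n : ℤ) := by
          rw [Finset.mem_Icc] at hℓ
          have := abs_le.2 hℓ
          omega
        exact_mod_cast this
    _ ≤ _ := Finset.sum_le_sum_of_subset_of_nonneg hsub fun ℓ _ _ => hH.nonneg _

theorem hbar_pos (hH : IsLowPassFilter H) {n : ℕ} (hn : 1 ≤ n) : 0 < hbar H n :=
  inv_pos.2 (lt_of_lt_of_le (by exact_mod_cast hn) (hH.le_sum hn))

theorem hbar_le (hH : IsLowPassFilter H) {n : ℕ} (hn : 1 ≤ n) : hbar H n ≤ 1 / n := by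
  rw [one_div]
  exact inv_anti₀ (by exact_mod_cast hn) (hH.le_sum hn)

theorem hbar_mul_sum (hH : IsLowPassFilter H) {n : ℕ} (hn : 1 ≤ n) :
    hbar H n * ∑ ℓ ∈ Finset.Ioo (-(n : ℤ)) n, H (|(ℓ : ℝ)| / n) = 1 :=
  inv_mul_cancel₀ (lt_of_lt_of_le (by exact_mod_cast hn) (hH.le_sum hn)).ne'

/-- The average of `|ℓ| / n` for the filter weights is at most `1 / 2`. -/
theorem hbar_mul_sum_abs_le (hH : IsLowPassFilter H) {n : ℕ} (hn : 1 ≤ n) :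
    hbar H n * ∑ ℓ ∈ Finset.Ioo (-(n : ℤ)) n, H (|(ℓ : ℝ)| / n) * (|(ℓ : ℝ)| / n) ≤ 1 / 2 := by
  have hn0 : (0 : ℝ) < n := by exact_mod_cast hn
  -- Termwise `H(u)(u - 1/2) ≤ u - 1/2`: equality for `u ≤ 1/2`, and `H ≤ 1` beyond. The unweighted
  -- sum is `-1/2`.
  have hle : ∑ ℓ ∈ Finset.Ioo (-(n : ℤ)) n, H (|(ℓ : ℝ)| / n) * (|(ℓ : ℝ)| / n - 1 / 2) ≤ 0 := by
    calc ∑ ℓ ∈ Finset.Ioo (-(n : ℤ)) n, H (|(ℓ : ℝ)| / n) * (|(ℓ : ℝ)| / n - 1 / 2)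
        ≤ ∑ ℓ ∈ Finset.Ioo (-(n : ℤ)) n, (|(ℓ : ℝ)| / n - 1 / 2) := by
          refine Finset.sum_le_sum fun ℓ _ => ?_
          rcases le_total (|(ℓ : ℝ)| / n) (1 / 2) with h | h
          · rw [hH.eq_one _ (by rwa [abs_of_nonneg (by positivity)]), one_mul]
          · exact mul_le_of_le_one_left (by linarith) (hH.le_one _)
      _ = (n * (n - 1) : ℝ) / n - (2 * n - 1) * (1 / 2) := by
          rw [Finset.sum_sub_distrib, ← Finset.sum_div, Finset.sum_const, nsmul_eq_mul,
            card_Ioo_neg n hn]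
          congr 2
          exact_mod_cast sum_abs_Ioo n hn
      _ ≤ 0 := by
          rw [mul_div_cancel_left₀ _ hn0.ne']
          linarith
  have h1 := hH.hbar_mul_sum hn
  have h2 := mul_nonpos_of_nonneg_of_nonpos (hH.hbar_pos hn).le hle
  simp only [mul_sub, Finset.sum_sub_distrib] at h2
  rw [← Finset.sum_mul] at h2
  linarith [mul_assoc (hbar H n) (∑ ℓ ∈ Finset.Ioo (-(n : ℤ)) n, H (|(ℓ : ℝ)| / n)) (1 / 2)]

/-! ### The localized kernel -/

theorem hasCompactSupport (hH : IsLowPassFilter H) : HasCompactSupport H := by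
  refine HasCompactSupport.intro (isCompact_Icc (a := (-1 : ℝ)) (b := 1)) fun t ht => ?_
  refine hH.eq_zero t ?_
  by_contra h
  exact ht (abs_le.1 (not_le.1 h).le)

theorem integral_abs_le (hH : IsLowPassFilter H) : ∫ t, |H t| ≤ 2 := by
  have : ∫ t, |H t| ≤ ∫ t, Set.indicator (Set.Icc (-1 : ℝ) 1) 1 t := by
    refine integral_mono_of_nonneg (.of_forall fun t => abs_nonneg _) ?_ (.of_forall fun t => ?_)
    · exact (integrable_indicator_iff measurableSet_Icc).2
        (integrableOn_const (by simp) (by simp))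
    · change |H t| ≤ _
      rw [abs_of_nonneg (hH.nonneg t)]
      by_cases ht : t ∈ Set.Icc (-1 : ℝ) 1
      · rw [Set.indicator_of_mem ht]
        exact hH.le_one t
      · rw [Set.indicator_of_notMem ht, hH.eq_zero t]
        by_contra h
        exact ht (abs_le.1 (not_le.1 h).le)
  refine this.trans ?_
  rw [integral_indicator_one measurableSet_Icc]
  norm_num [Measure.real]

theorem integral_abs_pos (hH : IsLowPassFilter H) : 0 < ∫ t, |H t| := by
  have hc : Continuous fun t => |H t| := hH.smooth.continuous.abs
  refine hc.integral_pos_of_hasCompactSupport_nonneg_nonzero (x := 0) ?_ (fun t => abs_nonneg _) ?_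
  · exact hH.hasCompactSupport.comp_left (g := abs) abs_zero
  · simp [hH.eq_one 0 (by norm_num)]

end IsLowPassFilter

end

/-! ### Poisson summation and the decay of the kernel. -/

section

open scoped FourierTransform in
theorem norm_fourier_le_integral_norm {E : Type*} [NormedAddCommGroup E] [NormedSpace ℂ E]
    (f : ℝ → E) (ξ : ℝ) : ‖𝓕 f ξ‖ ≤ ∫ t, ‖f t‖ :=
  VectorFourier.norm_fourierIntegral_le_integral_norm _ _ _ _ _

/-- Two copies of `ζ(2)`; the term `k = 0` is `1 / 0 = 0`. -/
theorem hasSum_one_div_int_sq :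
    HasSum (fun k : ℤ => 1 / (k : ℝ) ^ 2) (Real.pi ^ 2 / 3) := by
  have h := hasSum_zeta_two
  have h' : HasSum (fun k : ℕ => 1 / (((k + 1 : ℕ) : ℝ)) ^ 2) (Real.pi ^ 2 / 6) := by
    simpa using (hasSum_nat_add_iff' 1).2 h
  have := HasSum.of_nat_of_neg_add_one (f := fun k : ℤ => 1 / (k : ℝ) ^ 2)
    (by simpa using h) (m' := Real.pi ^ 2 / 6) (by
      refine h'.congr_fun fun k => ?_
      push_cast
      rw [neg_sq])
  convert this using 1
  ring

open scoped FourierTransform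

namespace IsLowPassFilter

variable {H : ℝ → ℝ}

theorem contDiff_ofReal (hH : IsLowPassFilter H) :
    ContDiff ℝ (⊤ : ℕ∞) (fun t => (H t : ℂ)) :=
  Complex.ofRealCLM.contDiff.comp hH.smooth

theorem hasCompactSupport_ofReal (hH : IsLowPassFilter H) :
    HasCompactSupport (fun t => (H t : ℂ)) :=
  hH.hasCompactSupport.comp_left (g := fun r : ℝ => (r : ℂ)) Complex.ofReal_zero

theorem norm_iteratedDeriv_ofReal (hH : IsLowPassFilter H) (S : ℕ) (t : ℝ) :
    ‖iteratedDeriv S (fun t => (H t : ℂ)) t‖ = |iteratedDeriv S H t| := by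
  rw [← norm_iteratedFDeriv_eq_norm_iteratedDeriv, ← Real.norm_eq_abs,
    ← norm_iteratedFDeriv_eq_norm_iteratedDeriv]
  exact Complex.ofRealLI.norm_iteratedFDeriv_comp_left
    (hH.smooth.contDiffAt.of_le (by exact_mod_cast le_top)) le_rfl

/-- The left side is the modulus of the Fourier transform of `H^{(S)}`, which is bounded by the `L¹`
norm. -/
theorem pow_mul_norm_fourier_le (hH : IsLowPassFilter H) (S : ℕ) (ξ : ℝ) :
    (2 * Real.pi * |ξ|) ^ S * ‖𝓕 (fun t => (H t : ℂ)) ξ‖ ≤ ∫ t, |iteratedDeriv S H t| := by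
  have h := Real.fourier_iteratedDeriv (n := S) hH.contDiff_ofReal (fun m _ => by
    refine (hH.contDiff_ofReal.continuous_iteratedDeriv m
      (by exact_mod_cast le_top)).integrable_of_hasCompactSupport ?_
    exact (hH.hasCompactSupport_ofReal.iteratedFDeriv m).comp_left
      (g := fun L : ContinuousMultilinearMap ℝ (fun _ : Fin m => ℝ) ℂ => L fun _ => 1) rfl) le_top
  have h2 := norm_fourier_le_integral_norm (iteratedDeriv S (fun t => (H t : ℂ))) ξ
  rw [h] at h2
  simp only [hH.norm_iteratedDeriv_ofReal] at h2
  refine le_trans (le_of_eq ?_) h2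
  simp [abs_of_pos Real.pi_pos]

theorem fourier_dilation_modulation (n : ℕ) (hn : 1 ≤ n) (x ξ : ℝ) :
    𝓕 (fun t : ℝ => (H (t / n) : ℂ) * Complex.exp ((t * x : ℝ) * Complex.I)) ξ
      = n * 𝓕 (fun t => (H t : ℂ)) (n * (ξ - x / (2 * Real.pi))) := by
  have hn0 : (n : ℝ) ≠ 0 := by positivity
  rw [Real.fourier_real_eq_integral_exp_smul, Real.fourier_real_eq_integral_exp_smul]
  have := Measure.integral_comp_div (fun v : ℝ =>
    Complex.exp (((-2 * Real.pi * v * (n * (ξ - x / (2 * Real.pi))) : ℝ) : ℂ) * Complex.I)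
      • (H v : ℂ)) (n : ℝ)
  rw [Nat.abs_cast, Complex.real_smul] at this
  rw [Complex.ofReal_natCast] at this
  rw [← this]
  refine integral_congr_ae (.of_forall fun v => ?_)
  simp only [smul_eq_mul]
  rw [mul_left_comm, ← Complex.exp_add, mul_comm (H _ : ℂ)]
  congr 2
  rw [← add_mul, ← Complex.ofReal_add]
  congr 2
  field_simp
  ring

/-- By Poisson summation the sum equals `n ∑_k Ĥ(n(k - x/2π))`. The decay of `Ĥ` bounds the term `k
= 0` by the main factor and the others by that factor over `k²`. -/
theorem norm_sum_exp_le (hH : IsLowPassFilter H) {n : ℕ} (hn : 1 ≤ n) {S : ℕ} (hS : 2 ≤ S)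
    {x : ℝ} (hx : 0 < |x|) (hx' : |x| ≤ Real.pi) :
    ‖∑ ℓ ∈ Finset.Ioo (-(n : ℤ)) n,
        (H (|(ℓ : ℝ)| / n) : ℂ) * Complex.exp ((ℓ * x : ℝ) * Complex.I)‖
      ≤ n * ((∫ t, |iteratedDeriv S H t|) / (n * |x|) ^ S) * (1 + Real.pi ^ 2 / 3) := by
  have hn0 : (0 : ℝ) < n := by exact_mod_cast hn
  set J := ∫ t, |iteratedDeriv S H t| with hJ
  have hJ0 : 0 ≤ J := integral_nonneg fun t => abs_nonneg _
  set h : ℝ → ℂ := fun t => (H (t / n) : ℂ) * Complex.exp ((t * x : ℝ) * Complex.I) with hh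
  have hsmooth : ContDiff ℝ (⊤ : ℕ∞) h := by
    refine (hH.contDiff_ofReal.comp (contDiff_id.div_const _)).mul ?_
    refine ContDiff.cexp (ContDiff.mul ?_ contDiff_const)
    exact Complex.ofRealCLM.contDiff.comp (contDiff_id.mul contDiff_const)
  have hzero : ∀ t : ℝ, (n : ℝ) ≤ |t| → h t = 0 := by
    intro t ht
    have : H (t / n) = 0 := hH.eq_zero _ (by
      rw [abs_div, Nat.abs_cast, le_div_iff₀ hn0]; linarith)
    simp [hh, this]
  have hsupp : HasCompactSupport h := by
    refine HasCompactSupport.intro (isCompact_Icc (a := (-n : ℝ)) (b := n)) fun t ht => ?_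
    refine hzero t ?_
    by_contra h
    exact ht (abs_le.1 (not_le.1 h).le)
  have hP := SchwartzMap.tsum_eq_tsum_fourier (hsupp.toSchwartzMap hsmooth) 0
  simp only [SchwartzMap.fourier_coe, zero_add, QuotientAddGroup.mk_zero, fourier_eval_zero,
    mul_one] at hP
  have hsum : ∑ ℓ ∈ Finset.Ioo (-(n : ℤ)) n,
        (H (|(ℓ : ℝ)| / n) : ℂ) * Complex.exp ((ℓ * x : ℝ) * Complex.I) = ∑' ℓ : ℤ, h ℓ := by
    rw [tsum_eq_sum (s := Finset.Ioo (-(n : ℤ)) n)]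
    · refine Finset.sum_congr rfl fun ℓ _ => ?_
      simp only [hh]
      rw [← hH.apply_abs ((ℓ : ℝ) / n), abs_div, Nat.abs_cast]
    · intro ℓ hℓ
      refine hzero _ ?_
      rw [mem_Ioo_iff_abs_lt, not_lt] at hℓ
      exact_mod_cast hℓ
  rw [hsum]
  have hP' : ∑' ℓ : ℤ, h ℓ = ∑' k : ℤ, 𝓕 h k := hP
  rw [hP']
  have hw : HasSum (fun k : ℤ => (if k = 0 then (1 : ℝ) else 0) + 1 / (k : ℝ) ^ 2)
      (1 + Real.pi ^ 2 / 3) := (hasSum_ite_eq 0 1).add hasSum_one_div_int_sq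
  refine tsum_of_norm_bounded (hw.mul_left _) fun k => ?_
  have hF : ‖𝓕 h k‖ = n * ‖𝓕 (fun t => (H t : ℂ)) (n * (k - x / (2 * Real.pi)))‖ := by
    rw [hh, fourier_dilation_modulation n hn, norm_mul, Complex.norm_natCast]
  rw [hF, mul_assoc]
  refine mul_le_mul_of_nonneg_left ?_ hn0.le
  have hd := hH.pow_mul_norm_fourier_le S (n * (k - x / (2 * Real.pi)))
  have hfreq : 2 * Real.pi * |n * (k - x / (2 * Real.pi))| = n * |2 * Real.pi * k - x| := by
    have : 2 * Real.pi * k - x = 2 * Real.pi * (k - x / (2 * Real.pi)) := by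
      have := Real.pi_pos
      field_simp
    rw [this, abs_mul, abs_mul, Nat.abs_cast, abs_of_pos Real.two_pi_pos]
    ring
  rw [hfreq, ← hJ] at hd
  set N := ‖𝓕 (fun t => (H t : ℂ)) (n * (k - x / (2 * Real.pi)))‖
  have hN : 0 ≤ N := norm_nonneg _
  by_cases hk : k = 0
  · simp only [hk, Int.cast_zero, mul_zero, zero_sub, abs_neg] at hd
    simp only [hk, if_true, Int.cast_zero, ne_eq, OfNat.ofNat_ne_zero, not_false_eq_true, zero_pow,
      div_zero, add_zero, mul_one]
    rw [le_div_iff₀ (by positivity)]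
    linarith
  · have hk1 : (1 : ℝ) ≤ |(k : ℝ)| := by exact_mod_cast Int.one_le_abs hk
    -- Since `|x| ≤ π` and `|k| ≥ 1`, `2π|k| - |x| ≥ (2|k| - 1)|x| ≥ |k||x|`.
    have hlow : |x| * |(k : ℝ)| ≤ |2 * Real.pi * k - x| := by
      have h1 := abs_sub_abs_le_abs_sub (2 * Real.pi * k) x
      rw [abs_mul, abs_of_pos Real.two_pi_pos] at h1
      nlinarith [Real.pi_pos]
    simp only [hk, if_false, zero_add]
    have hk2 : (k : ℝ) ^ 2 ≤ |(k : ℝ)| ^ S := by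
      rw [← sq_abs]
      exact pow_le_pow_right₀ hk1 hS
    have hk3 : 0 < (k : ℝ) ^ 2 := by positivity
    rw [div_mul_div_comm, mul_one, le_div_iff₀ (by positivity)]
    calc N * ((n * |x|) ^ S * (k : ℝ) ^ 2) ≤ N * ((n * |x|) ^ S * |(k : ℝ)| ^ S) := by gcongr
      _ = (n * (|x| * |(k : ℝ)|)) ^ S * N := by rw [← mul_pow]; ring
      _ ≤ (n * |2 * Real.pi * k - x|) ^ S * N := by gcongr
      _ ≤ J := hd

end IsLowPassFilter

theorem locConst_nonneg (H : ℝ → ℝ) (S : ℕ) : 0 ≤ locConst H S := by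
  unfold locConst
  have : 0 ≤ ∫ t, |iteratedDeriv S H t| := integral_nonneg fun t => abs_nonneg _
  have : 0 ≤ ∫ t, |H t| := integral_nonneg fun t => abs_nonneg _
  positivity

/-- The summability kernel `Φ_n(x) = ħ_n ∑_{|ℓ| < n} H(|ℓ| / n) exp(i ℓ x)`. -/
noncomputable def filterKernel (H : ℝ → ℝ) (n : ℕ) (x : Torus) : ℂ :=
  (hbar H n : ℂ) * ∑ ℓ ∈ Finset.Ioo (-(n : ℤ)) n, (H (|(ℓ : ℝ)| / n) : ℂ) * fourier ℓ x

namespace IsLowPassFilter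

variable {H : ℝ → ℝ}

theorem norm_filterKernel_le (hH : IsLowPassFilter H) {n : ℕ} (hn : 1 ≤ n) {S : ℕ} (hS : 2 ≤ S)
    {x : Torus} (hx : 0 < ‖x‖) :
    ‖filterKernel H n x‖ ≤ locConst H S / (n * ‖x‖) ^ S := by
  have hn0 : (0 : ℝ) < n := by exact_mod_cast hn
  obtain ⟨y, rfl, hy⟩ := exists_coe_eq_abs_eq_norm x
  have h := hH.norm_sum_exp_le hn hS (x := y) (hy ▸ hx) (hy ▸ norm_le_pi _)
  rw [hy] at h
  set J := ∫ t, |iteratedDeriv S H t| with hJ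
  have hJ0 : 0 ≤ J := integral_nonneg fun t => abs_nonneg _
  have hI := hH.integral_abs_le
  have hI0 := hH.integral_abs_pos
  set D := ((n : ℝ) * ‖(y : Torus)‖) ^ S
  have hD : 0 < D := by positivity
  unfold filterKernel
  simp only [fourier_coe_eq_exp]
  rw [norm_mul, Complex.norm_real, Real.norm_of_nonneg (hH.hbar_pos hn).le]
  -- The factor `1 + π²/3` comes from the Poisson series and `2` from `‖H‖₁ ≤ 2`; together they fit
  -- under the constant in `L`.
  have hpi : 2 * (1 + Real.pi ^ 2 / 3) ≤ 14 * Real.sqrt (2 * Real.pi) / 3 := by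
    have h1 := Real.pi_lt_d2
    have h2 := Real.pi_gt_d2
    have h3 : 5 / 2 ≤ Real.sqrt (2 * Real.pi) := Real.le_sqrt_of_sq_le (by linarith)
    nlinarith
  calc _ ≤ 1 / n * (n * (J / D) * (1 + Real.pi ^ 2 / 3)) :=
        mul_le_mul (hH.hbar_le hn) h (norm_nonneg _) (by positivity)
    _ = (1 + Real.pi ^ 2 / 3) * J / D := by field_simp
    _ ≤ locConst H S / D := by
        gcongr
        unfold locConst
        rw [← hJ, mul_div_assoc', le_div_iff₀ hI0]
        calc (1 + Real.pi ^ 2 / 3) * J * ∫ t, |H t| ≤ (1 + Real.pi ^ 2 / 3) * J * 2 := by gcongr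
          _ = 2 * (1 + Real.pi ^ 2 / 3) * J := by ring
          _ ≤ _ := by gcongr

/-- The real part is a weighted mean of `cos(ℓx)` with `|ℓx| ≤ 1/4`, and `1 - (1/4)²/2 = 31/32`. -/
theorem le_norm_filterKernel (hH : IsLowPassFilter H) {n : ℕ} (hn : 1 ≤ n) {x : Torus}
    (hx : ‖x‖ ≤ 1 / (4 * n)) : 31 / 32 ≤ ‖filterKernel H n x‖ := by
  have hn0 : (0 : ℝ) < n := by exact_mod_cast hn
  obtain ⟨y, rfl, hy⟩ := exists_coe_eq_abs_eq_norm x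
  refine le_trans ?_ ((le_abs_self _).trans (Complex.abs_re_le_norm _))
  unfold filterKernel
  rw [Complex.re_ofReal_mul, Complex.re_sum]
  simp only [fourier_coe_eq_exp, Complex.re_ofReal_mul, Complex.exp_ofReal_mul_I_re]
  calc (31 / 32 : ℝ) = hbar H n * ∑ ℓ ∈ Finset.Ioo (-(n : ℤ)) n, H (|(ℓ : ℝ)| / n) * (31 / 32) := by
        rw [← Finset.sum_mul, ← mul_assoc, hH.hbar_mul_sum hn, one_mul]
    _ ≤ _ := by
        refine mul_le_mul_of_nonneg_left (Finset.sum_le_sum fun ℓ hℓ => ?_) (hH.hbar_pos hn).le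
        refine mul_le_mul_of_nonneg_left ?_ (hH.nonneg _)
        have hℓ' : |(ℓ : ℝ)| ≤ n := by
          rw [mem_Ioo_iff_abs_lt] at hℓ
          exact_mod_cast hℓ.le
        have hb : |(ℓ : ℝ) * y| ≤ 1 / 4 := by
          rw [abs_mul, hy]
          calc _ ≤ (n : ℝ) * (1 / (4 * n)) := by gcongr
            _ = 1 / 4 := by field_simp
        have h1 := Real.one_sub_sq_div_two_le_cos (x := (ℓ : ℝ) * y)
        have h2 : ((ℓ : ℝ) * y) ^ 2 ≤ (1 / 4) ^ 2 := sq_le_sq' (abs_le.1 hb).1 (abs_le.1 hb).2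
        linarith

end IsLowPassFilter

end

section

/-! ### Local linearization of the components -/

theorem norm_exp_I_sub_exp_I_le (a b : ℝ) :
    ‖Complex.exp (Complex.I * a) - Complex.exp (Complex.I * b)‖ ≤ |a - b| := by
  have h : Complex.exp (Complex.I * a) - Complex.exp (Complex.I * b)
      = Complex.exp (Complex.I * b) * (Complex.exp (Complex.I * ((a - b : ℝ) : ℂ)) - 1) := by
    rw [mul_sub, ← Complex.exp_add, mul_one]
    congr 2
    push_cast
    ring
  rw [h, norm_mul, mul_comm Complex.I (b : ℂ), Complex.norm_exp_ofReal_mul_I, one_mul]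
  exact Real.norm_exp_I_mul_ofReal_sub_one_le

/-- Mean value inequality for `ψ(s) - s ψ'(t)`. -/
theorem abs_sub_linearization_le {ψ ψ' : ℝ → ℝ} {t Δ α u : ℝ} (hα : 0 ≤ α)
    (hd : ∀ s ∈ Set.Icc (t - Δ) (t + Δ), HasDerivWithinAt ψ (ψ' s) (Set.Icc (t - Δ) (t + Δ)) s)
    (hslow : ∀ u : ℝ, |u| ≤ Δ → |ψ' (t + u) - ψ' t| ≤ α * |u| * |ψ' t|) (hu : |u| ≤ Δ) :
    |ψ (t + u) - (ψ t + u * ψ' t)| ≤ α * |u| * |ψ' t| * |u| := by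
  have hsub : Set.uIcc t (t + u) ⊆ Set.Icc (t - Δ) (t + Δ) := by
    obtain ⟨h1, h2⟩ := abs_le.1 hu
    have h0 := (abs_nonneg u).trans hu
    exact Set.uIcc_subset_Icc ⟨by linarith, by linarith⟩ ⟨by linarith, by linarith⟩
  have h := (convex_uIcc t (t + u)).norm_image_sub_le_of_norm_hasDerivWithin_le
    (f := fun s => ψ s - s * ψ' t) (f' := fun s => ψ' s - 1 * ψ' t) (C := α * |u| * |ψ' t|)
    (x := t) (y := t + u)
    (fun s hs => ((hd s (hsub hs)).mono hsub).sub ((hasDerivWithinAt_id s _).mul_const _))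
    (fun s hs => by
      have hsu : |s - t| ≤ |u| := by
        have := Set.abs_sub_left_of_mem_uIcc hs
        simpa using this
      have := hslow (s - t) (hsu.trans hu)
      rw [add_sub_cancel] at this
      rw [one_mul, Real.norm_eq_abs]
      refine this.trans ?_
      gcongr)
    Set.left_mem_uIcc Set.right_mem_uIcc
  simp only [Real.norm_eq_abs, add_sub_cancel_left] at h
  refine le_trans (le_of_eq ?_) h
  congr 1
  ring

variable {K : ℕ}

theorem norm_component (A : Fin K → ℝ → ℂ) (φ : Fin K → ℝ → ℝ) (j : Fin K) (s : ℝ) :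
    ‖component A φ j s‖ = ‖A j s‖ := by
  rw [component, norm_mul, mul_comm Complex.I, Complex.norm_exp_ofReal_mul_I, mul_one]

theorem norm_component_sub_linearization_le {A : Fin K → ℝ → ℂ} {φ φ' : Fin K → ℝ → ℝ}
    {t Δ α u : ℝ} (j : Fin K) (hα : 0 ≤ α)
    (hd : ∀ s ∈ Set.Icc (t - Δ) (t + Δ),
      HasDerivWithinAt (φ j) (φ' j s) (Set.Icc (t - Δ) (t + Δ)) s)
    (hA : ∀ u : ℝ, |u| ≤ Δ → ‖A j (t + u) - A j t‖ ≤ α * |u| * ‖A j t‖)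
    (hφ : ∀ u : ℝ, |u| ≤ Δ → |φ' j (t + u) - φ' j t| ≤ α * |u| * |φ' j t|) (hu : |u| ≤ Δ) :
    ‖component A φ j (t + u)
        - component A φ j t * Complex.exp (Complex.I * ((u * φ' j t : ℝ) : ℂ))‖
      ≤ ‖A j t‖ * (α * |u| * (1 + |φ' j t| * |u|)) := by
  have hsplit : component A φ j (t + u)
        - component A φ j t * Complex.exp (Complex.I * ((u * φ' j t : ℝ) : ℂ))
      = (A j (t + u) - A j t) * Complex.exp (Complex.I * (φ j (t + u) : ℂ))
        + A j t * (Complex.exp (Complex.I * (φ j (t + u) : ℂ))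
          - Complex.exp (Complex.I * ((φ j t + u * φ' j t : ℝ) : ℂ))) := by
    have : Complex.exp (Complex.I * ((φ j t + u * φ' j t : ℝ) : ℂ))
        = Complex.exp (Complex.I * (φ j t : ℂ))
          * Complex.exp (Complex.I * ((u * φ' j t : ℝ) : ℂ)) := by
      rw [← Complex.exp_add, ← mul_add, Complex.ofReal_add]
    rw [this]
    unfold component
    ring
  rw [hsplit]
  refine (norm_add_le _ _).trans ?_
  rw [norm_mul, norm_mul, mul_comm Complex.I (φ j (t + u) : ℂ), Complex.norm_exp_ofReal_mul_I,
    mul_one, mul_comm _ Complex.I]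
  have h1 := hA u hu
  have h2 := (norm_exp_I_sub_exp_I_le (φ j (t + u)) (φ j t + u * φ' j t)).trans
    (abs_sub_linearization_le hα hd hφ hu)
  have h3 := mul_le_mul_of_nonneg_left h2 (norm_nonneg (A j t))
  calc _ ≤ α * |u| * ‖A j t‖ + ‖A j t‖ * (α * |u| * |φ' j t| * |u|) := add_le_add h1 h3
    _ = _ := by ring

theorem abs_le_maxFreq (φ' : Fin K → ℝ → ℝ) (t : ℝ) (j : Fin K) : |φ' j t| ≤ maxFreq φ' t :=
  le_ciSup (f := fun j => |φ' j t|) (Set.finite_range _).bddAbove j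

theorem maxFreq_nonneg (φ' : Fin K → ℝ → ℝ) (t : ℝ) : 0 ≤ maxFreq φ' t :=
  Real.iSup_nonneg fun _ => abs_nonneg _

theorem minAmp_le (A : Fin K → ℝ → ℂ) (φ : Fin K → ℝ → ℝ) (t : ℝ) (j : Fin K) :
    minAmp A φ t ≤ ‖component A φ j t‖ :=
  ciInf_le (f := fun j => ‖component A φ j t‖) (Set.finite_range _).bddBelow j

theorem totalAmp_nonneg (A : Fin K → ℝ → ℂ) (t : ℝ) : 0 ≤ totalAmp A t :=
  Finset.sum_nonneg fun _ _ => norm_nonneg _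

/-- The separation operator sends the noisy signal to a sum of translated kernels plus the
transformed noise, up to the linearization error. -/
theorem norm_sepOp_noisySignal_sub_le {H : ℝ → ℝ} (hH : IsLowPassFilter H) {n : ℕ} (hn : 1 ≤ n)
    {A : Fin K → ℝ → ℂ} {φ φ' : Fin K → ℝ → ℝ} {t Δ α R : ℝ} (hα : 0 ≤ α) (hR : 0 < R)
    (hnR : (n : ℝ) ≤ R * Δ)
    (hd : ∀ j, ∀ s ∈ Set.Icc (t - Δ) (t + Δ),
      HasDerivWithinAt (φ j) (φ' j s) (Set.Icc (t - Δ) (t + Δ)) s)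
    (hA : ∀ j, ∀ u : ℝ, |u| ≤ Δ → ‖A j (t + u) - A j t‖ ≤ α * |u| * ‖A j t‖)
    (hφ : ∀ j, ∀ u : ℝ, |u| ≤ Δ → |φ' j (t + u) - φ' j t| ≤ α * |u| * |φ' j t|)
    (e : ℝ → ℂ) (x : Torus) :
    ‖sepOp H n R (noisySignal A φ e) t x
        - ∑ j, component A φ j t * filterKernel H n (x - redFreq φ' R t j)
        - sepOp H n R e t x‖ ≤ α * totalAmp A t * (maxFreq φ' t * Δ + 1) * Δ / 2 := by
  have hn0 : (0 : ℝ) < n := by exact_mod_cast hn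
  have hΔ : 0 < Δ := pos_of_mul_pos_right (hn0.trans_le hnR) hR.le
  have hB := maxFreq_nonneg φ' t
  have hM := totalAmp_nonneg A t
  have hrepr : sepOp H n R (noisySignal A φ e) t x
        - ∑ j, component A φ j t * filterKernel H n (x - redFreq φ' R t j)
        - sepOp H n R e t x
      = (hbar H n : ℂ) * ∑ ℓ ∈ Finset.Ioo (-(n : ℤ)) n, (H (|(ℓ : ℝ)| / n) : ℂ)
          * (∑ j, (component A φ j (t - (ℓ : ℝ) / R)
            - component A φ j t * fourier (-ℓ) (redFreq φ' R t j))) * fourier ℓ x := by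
    have hker : ∑ j, component A φ j t * filterKernel H n (x - redFreq φ' R t j)
        = (hbar H n : ℂ) * ∑ ℓ ∈ Finset.Ioo (-(n : ℤ)) n, (H (|(ℓ : ℝ)| / n) : ℂ)
          * (∑ j, component A φ j t * fourier (-ℓ) (redFreq φ' R t j)) * fourier ℓ x := by
      simp only [filterKernel, fourier_apply_sub, Finset.mul_sum, Finset.sum_mul]
      rw [Finset.sum_comm]
      refine Finset.sum_congr rfl fun ℓ _ => Finset.sum_congr rfl fun j _ => ?_
      ring
    rw [hker]
    unfold sepOp noisySignal
    rw [← mul_sub, ← mul_sub, ← Finset.sum_sub_distrib, ← Finset.sum_sub_distrib]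
    congr 1
    refine Finset.sum_congr rfl fun ℓ _ => ?_
    rw [Finset.sum_sub_distrib]
    ring
  rw [hrepr, norm_mul, Complex.norm_real, Real.norm_of_nonneg (hH.hbar_pos hn).le]
  have hterm : ∀ ℓ ∈ Finset.Ioo (-(n : ℤ)) n,
      ‖(H (|(ℓ : ℝ)| / n) : ℂ) * (∑ j, (component A φ j (t - (ℓ : ℝ) / R)
            - component A φ j t * fourier (-ℓ) (redFreq φ' R t j))) * fourier ℓ x‖
        ≤ H (|(ℓ : ℝ)| / n) * (|(ℓ : ℝ)| / n)
          * (α * totalAmp A t * (maxFreq φ' t * Δ + 1) * Δ) := by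
    intro ℓ hℓ
    rw [norm_mul, norm_fourier_apply, mul_one, norm_mul, Complex.norm_real,
      Real.norm_of_nonneg (hH.nonneg _), mul_assoc]
    refine mul_le_mul_of_nonneg_left ?_ (hH.nonneg _)
    have hℓn : |(ℓ : ℝ)| ≤ n := by
      rw [mem_Ioo_iff_abs_lt] at hℓ
      exact_mod_cast hℓ.le
    -- Keeping the factor `|ℓ|/n`, instead of bounding it by `1`, is what later gains the `1/2`.
    have hu1 : |-((ℓ : ℝ) / R)| ≤ |(ℓ : ℝ)| / n * Δ := by
      rw [abs_neg, abs_div, abs_of_pos hR, div_le_iff₀ hR]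
      calc |(ℓ : ℝ)| = |(ℓ : ℝ)| / n * n := by field_simp
        _ ≤ |(ℓ : ℝ)| / n * (R * Δ) := by gcongr
        _ = _ := by ring
    have hu2 : |-((ℓ : ℝ) / R)| ≤ Δ :=
      hu1.trans (mul_le_of_le_one_left hΔ.le ((div_le_one hn0).2 hℓn))
    calc _ ≤ ∑ j, ‖A j t‖ * (α * (|(ℓ : ℝ)| / n * Δ) * (1 + maxFreq φ' t * Δ)) := by
          refine norm_sum_le_of_le _ fun j _ => ?_
          have h := norm_component_sub_linearization_le j hα (hd j) (hA j) (hφ j) hu2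
          have hexp : fourier (-ℓ) (redFreq φ' R t j)
              = Complex.exp (Complex.I * ((-((ℓ : ℝ) / R) * φ' j t : ℝ) : ℂ)) := by
            rw [redFreq, fourier_coe_eq_exp, mul_comm]
            congr 3
            push_cast
            ring
          rw [hexp, sub_eq_add_neg t]
          refine h.trans ?_
          have := abs_le_maxFreq φ' t j
          gcongr
      _ = _ := by
          rw [← Finset.sum_mul, ← totalAmp]
          ring
  refine (mul_le_mul_of_nonneg_left (norm_sum_le_of_le _ hterm) (hH.hbar_pos hn).le).trans ?_
  rw [← Finset.sum_mul, ← mul_assoc]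
  have := mul_le_mul_of_nonneg_right (hH.hbar_mul_sum_abs_le hn)
    (show 0 ≤ α * totalAmp A t * (maxFreq φ' t * Δ + 1) * Δ by positivity)
  linarith

end

section

/-! ### The noise -/

section SubGaussian

variable {Ω : Type*} [MeasurableSpace Ω] {P : Measure Ω}

theorem IsSubGaussian.hasSubgaussianMGF [IsProbabilityMeasure P] {X : Ω → ℝ} {ν : ℝ}
    (h : IsSubGaussian X ν P) : HasSubgaussianMGF X (ν ^ 2).toNNReal P where
  integrable_exp_mul := h.integrable_exp
  mgf_le s := by
    have hpos : 0 < mgf X P s := mgf_pos (h.integrable_exp s)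
    have hlog := h.log_mgf_le s
    rw [Real.coe_toNNReal _ (sq_nonneg ν), ← Real.log_le_iff_le_exp hpos]
    refine hlog.trans (le_of_eq ?_)
    ring

theorem hasSubgaussianMGF_mono {X : Ω → ℝ} {c c' : NNReal} (h : HasSubgaussianMGF X c P)
    (hc : c ≤ c') : HasSubgaussianMGF X c' P where
  integrable_exp_mul := h.integrable_exp_mul
  mgf_le s := (h.mgf_le s).trans (by
    have : (c : ℝ) ≤ c' := hc
    gcongr)

/-- Positivity of `c` matters: for `c = 0` the exponent `-τ²/(2c)` takes the default value `0`. -/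
theorem measureReal_le_abs_le {X : Ω → ℝ} {c : NNReal} [IsProbabilityMeasure P]
    (h : HasSubgaussianMGF X c P) (hc : 0 < c) {τ q : ℝ} (hτ : 0 ≤ τ) (hq : 2 * c * q ≤ τ ^ 2) :
    P.real {ω | τ ≤ |X ω|} ≤ 2 * Real.exp (-q) := by
  have hle : Real.exp (-τ ^ 2 / (2 * c)) ≤ Real.exp (-q) := by
    refine Real.exp_le_exp.2 ?_
    have : (0 : ℝ) < c := hc
    rw [div_le_iff₀ (by positivity)]
    linarith
  have hset : {ω | τ ≤ |X ω|} ⊆ {ω | τ ≤ X ω} ∪ {ω | τ ≤ (-X) ω} := fun ω hω => by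
    simpa [le_abs] using hω
  calc _ ≤ P.real ({ω | τ ≤ X ω} ∪ {ω | τ ≤ (-X) ω}) := measureReal_mono hset
    _ ≤ P.real {ω | τ ≤ X ω} + P.real {ω | τ ≤ (-X) ω} := measureReal_union_le _ _
    _ ≤ Real.exp (-q) + Real.exp (-q) :=
        add_le_add ((h.measure_ge_le hτ).trans hle) ((h.neg.measure_ge_le hτ).trans hle)
    _ = _ := by ring

/-- Simultaneous tail bound for finitely many sub-Gaussian variables. -/
theorem exists_event_forall_abs_lt [IsProbabilityMeasure P] {ι : Type*} [Fintype ι]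
    {Y : ι → Ω → ℝ} (hY : ∀ i, Measurable (Y i)) {c : ι → NNReal} (hc : ∀ i, 0 < c i)
    (h : ∀ i, HasSubgaussianMGF (Y i) (c i) P) {τ : ι → ℝ} {q : ℝ} (hτ : ∀ i, 0 ≤ τ i)
    (hq : ∀ i, 2 * c i * q ≤ τ i ^ 2) :
    ∃ E : Set Ω, MeasurableSet E ∧ 1 - Fintype.card ι * (2 * Real.exp (-q)) ≤ P.real E ∧
      ∀ ω ∈ E, ∀ i, |Y i ω| < τ i := by
  have hmeas : MeasurableSet (⋃ i, {ω | τ i ≤ |Y i ω|}) :=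
    MeasurableSet.iUnion fun i => measurableSet_le measurable_const (hY i).abs
  refine ⟨(⋃ i, {ω | τ i ≤ |Y i ω|})ᶜ, hmeas.compl, ?_, fun ω hω i => ?_⟩
  · rw [probReal_compl_eq_one_sub hmeas]
    have h1 : P.real (⋃ i, {ω | τ i ≤ |Y i ω|}) ≤ ∑ i, P.real {ω | τ i ≤ |Y i ω|} :=
      measureReal_iUnion_fintype_le _
    have h2 : ∑ i, P.real {ω | τ i ≤ |Y i ω|} ≤ ∑ _i : ι, 2 * Real.exp (-q) :=
      Finset.sum_le_sum fun i _ => measureReal_le_abs_le (h i) (hc i) (hτ i) (hq i)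
    rw [Finset.sum_const, nsmul_eq_mul, Finset.card_univ] at h2
    linarith
  · by_contra hcon
    exact hω (Set.mem_iUnion.2 ⟨i, not_lt.1 hcon⟩)

/-- The real part (for `true`) or the imaginary part (for `false`). -/
def reIm (b : Bool) (z : ℂ) : ℝ := if b then z.re else z.im

theorem measurable_reIm (b : Bool) : Measurable (reIm b) := by
  cases b
  · exact Complex.measurable_im
  · exact Complex.measurable_re

theorem abs_reIm_le_norm (b : Bool) (z : ℂ) : |reIm b z| ≤ ‖z‖ := by
  cases b
  · exact Complex.abs_im_le_norm z
  · exact Complex.abs_re_le_norm z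

theorem IsComplexSubGaussian.hasSubgaussianMGF [IsProbabilityMeasure P] {X : Ω → ℂ} {ν : ℝ}
    (h : IsComplexSubGaussian X ν P) (b : Bool) :
    HasSubgaussianMGF (fun ω => reIm b (X ω)) (ν ^ 2).toNNReal P := by
  cases b
  · exact h.2.hasSubgaussianMGF
  · exact h.1.hasSubgaussianMGF

theorem IsComplexSubGaussian.mono {X : Ω → ℂ} {ν ν' : ℝ} (h : IsComplexSubGaussian X ν P)
    (h0 : 0 ≤ ν) (hν : ν ≤ ν') : IsComplexSubGaussian X ν' P := by
  have key : ∀ s : ℝ, (s * ν) ^ 2 / 2 ≤ (s * ν') ^ 2 / 2 := fun s => by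
    rw [mul_pow, mul_pow]
    gcongr
  exact ⟨⟨h.1.mean_zero, h.1.integrable_exp, fun s => (h.1.log_mgf_le s).trans (key s)⟩,
    ⟨h.2.mean_zero, h.2.integrable_exp, fun s => (h.2.log_mgf_le s).trans (key s)⟩⟩

/-- At most `2n` independent terms, each with variance proxy at most `V²/n²`. -/
theorem hasSubgaussianMGF_weighted_sum [IsProbabilityMeasure P] {T : Type*} [Fintype T]
    {X : T → Ω → ℂ} {V : ℝ} (hX : ∀ ℓ, IsComplexSubGaussian (X ℓ) V P) (hind : iIndepFun X P)
    {w : T → ℝ} {n : ℕ} (hn : 1 ≤ n) (hw : ∀ ℓ, |w ℓ| ≤ 1 / n)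
    (hT : Fintype.card T ≤ 2 * n) (b : Bool) :
    HasSubgaussianMGF (fun ω => ∑ ℓ, w ℓ * reIm b (X ℓ ω)) (2 * V ^ 2 / n).toNNReal P := by
  have hn0 : (0 : ℝ) < n := by exact_mod_cast hn
  have hind' : iIndepFun (fun ℓ ω => w ℓ * reIm b (X ℓ ω)) P :=
    hind.comp (fun ℓ z => w ℓ * reIm b z) fun ℓ => (measurable_reIm b).const_mul _
  refine hasSubgaussianMGF_mono (HasSubgaussianMGF.sum_of_iIndepFun hind' (s := Finset.univ)
    fun ℓ _ => ((hX ℓ).hasSubgaussianMGF b).const_mul (w ℓ)) ?_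
  rw [← NNReal.coe_le_coe, Real.coe_toNNReal _ (by positivity), NNReal.coe_sum]
  calc _ ≤ ∑ _ℓ : T, (1 / n : ℝ) ^ 2 * V ^ 2 := by
        refine Finset.sum_le_sum fun ℓ _ => ?_
        change w ℓ ^ 2 * ((V ^ 2).toNNReal : ℝ) ≤ _
        rw [Real.coe_toNNReal _ (sq_nonneg V)]
        refine mul_le_mul_of_nonneg_right ?_ (sq_nonneg V)
        exact sq_le_sq' (abs_le.1 (hw ℓ)).1 (abs_le.1 (hw ℓ)).2
    _ = (Fintype.card T : ℝ) * ((1 / n : ℝ) ^ 2 * V ^ 2) := by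
        rw [Finset.sum_const, nsmul_eq_mul, Finset.card_univ]
    _ ≤ (2 * n : ℝ) * ((1 / n : ℝ) ^ 2 * V ^ 2) := by
        gcongr
        exact_mod_cast hT
    _ = _ := by field_simp

end SubGaussian

end

/-! ### Noise bounds uniform over the circle. -/

section

/-- Real and imaginary parts of one sample may be dependent, so a complex sum is controlled through
four real sums. -/
theorem norm_sum_mul_le_of_reIm {T : Type*} [Fintype T] (c z : T → ℂ) {τ : ℝ}
    (h : ∀ b b' : Bool, |∑ ℓ, reIm b (c ℓ) * reIm b' (z ℓ)| ≤ τ) :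
    ‖∑ ℓ, c ℓ * z ℓ‖ ≤ 4 * τ := by
  refine (Complex.norm_le_abs_re_add_abs_im _).trans ?_
  rw [Complex.re_sum, Complex.im_sum]
  simp only [Complex.mul_re, Complex.mul_im, Finset.sum_sub_distrib, Finset.sum_add_distrib]
  have h1 := abs_sub (∑ ℓ, (c ℓ).re * (z ℓ).re) (∑ ℓ, (c ℓ).im * (z ℓ).im)
  have h2 := abs_add_le (∑ ℓ, (c ℓ).re * (z ℓ).im) (∑ ℓ, (c ℓ).im * (z ℓ).re)
  have htt : |∑ ℓ, (c ℓ).re * (z ℓ).re| ≤ τ := h true true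
  have hff : |∑ ℓ, (c ℓ).im * (z ℓ).im| ≤ τ := h false false
  have htf : |∑ ℓ, (c ℓ).re * (z ℓ).im| ≤ τ := h true false
  have hft : |∑ ℓ, (c ℓ).im * (z ℓ).re| ≤ τ := h false true
  linarith

theorem norm_fourier_coe_sub_le (ℓ : ℤ) (x y : ℝ) :
    ‖fourier ℓ (x : Torus) - fourier ℓ (y : Torus)‖ ≤ |(ℓ : ℝ)| * |x - y| := by
  rw [fourier_coe_eq_exp, fourier_coe_eq_exp, mul_comm _ Complex.I, mul_comm _ Complex.I,
    ← abs_mul, mul_sub]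
  exact norm_exp_I_sub_exp_I_le _ _

/-- Frequencies below `n` and samples bounded by `M` give the Lipschitz constant `Mn`. -/
theorem norm_sepOp_sub_le {H : ℝ → ℝ} (hH : IsLowPassFilter H) {n : ℕ} (hn : 1 ≤ n) {R t M : ℝ}
    {e : ℝ → ℂ} (he : ∀ ℓ ∈ Finset.Ioo (-(n : ℤ)) n, ‖e (t - (ℓ : ℝ) / R)‖ ≤ M) (x y : ℝ) :
    ‖sepOp H n R e t (x : Torus) - sepOp H n R e t (y : Torus)‖ ≤ M * (n * |x - y|) := by
  unfold sepOp
  rw [← mul_sub, ← Finset.sum_sub_distrib, norm_mul, Complex.norm_real,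
    Real.norm_of_nonneg (hH.hbar_pos hn).le]
  calc _ ≤ hbar H n * ∑ ℓ ∈ Finset.Ioo (-(n : ℤ)) n, H (|(ℓ : ℝ)| / n) * (M * (n * |x - y|)) := by
        refine mul_le_mul_of_nonneg_left (norm_sum_le_of_le _ fun ℓ hℓ => ?_) (hH.hbar_pos hn).le
        rw [← mul_sub, norm_mul, norm_mul, Complex.norm_real, Real.norm_of_nonneg (hH.nonneg _),
          mul_assoc]
        refine mul_le_mul_of_nonneg_left ?_ (hH.nonneg _)
        have hℓn : |(ℓ : ℝ)| ≤ n := by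
          rw [mem_Ioo_iff_abs_lt] at hℓ
          exact_mod_cast hℓ.le
        refine mul_le_mul (he ℓ hℓ) ((norm_fourier_coe_sub_le ℓ x y).trans ?_) (norm_nonneg _)
          ((norm_nonneg _).trans (he ℓ hℓ))
        gcongr
    _ = _ := by rw [← Finset.sum_mul, ← mul_assoc, hH.hbar_mul_sum hn, one_mul]

theorem exists_grid_point {N : ℕ} (hN : 0 < N) (x : Torus) :
    ∃ y : ℝ, (y : Torus) = x ∧ ∃ k : Fin N, |y - 2 * Real.pi * k / N| ≤ 2 * Real.pi / N := by
  have hN0 : (0 : ℝ) < N := by exact_mod_cast hN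
  have : Fact (0 < 2 * Real.pi) := ⟨Real.two_pi_pos⟩
  obtain ⟨h0, h1⟩ := (AddCircle.equivIco (2 * Real.pi) 0 x).2
  have hx : (((AddCircle.equivIco (2 * Real.pi) 0 x : Set.Ico _ _) : ℝ) : Torus) = x :=
    AddCircle.coe_equivIco
  generalize ((AddCircle.equivIco (2 * Real.pi) 0 x : Set.Ico _ _) : ℝ) = y at h0 h1 hx
  rw [zero_add] at h1
  have hk0 : 0 ≤ y * N / (2 * Real.pi) := by positivity
  have hk : ⌊y * N / (2 * Real.pi)⌋₊ < N := by
    rw [Nat.floor_lt hk0, div_lt_iff₀ Real.two_pi_pos]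
    nlinarith
  refine ⟨y, hx, ⟨_, hk⟩, ?_⟩
  have h2 := Nat.floor_le hk0
  have h3 := (Nat.lt_floor_add_one (y * N / (2 * Real.pi))).le
  rw [le_div_iff₀ Real.two_pi_pos] at h2
  rw [div_le_iff₀ Real.two_pi_pos] at h3
  rw [abs_of_nonneg]
  · rw [sub_le_iff_le_add, ← add_div, le_div_iff₀ hN0]
    dsimp only
    linarith
  · rw [sub_nonneg, div_le_iff₀ hN0]
    dsimp only
    linarith

theorem norm_sepOp_le_of_grid {H : ℝ → ℝ} (hH : IsLowPassFilter H) {n : ℕ} (hn : 1 ≤ n)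
    {R t M a : ℝ} {e : ℝ → ℂ}
    (he : ∀ ℓ ∈ Finset.Ioo (-(n : ℤ)) n, ‖e (t - (ℓ : ℝ) / R)‖ ≤ M)
    (ha : ∀ k : Fin (n ^ 2),
      ‖sepOp H n R e t ((2 * Real.pi * k / (n ^ 2 : ℕ) : ℝ) : Torus)‖ ≤ a) (x : Torus) :
    ‖sepOp H n R e t x‖ ≤ a + M * (2 * Real.pi / n) := by
  have hn0 : (0 : ℝ) < n := by exact_mod_cast hn
  have hM : 0 ≤ M := (norm_nonneg _).trans (he 0 (by rw [Finset.mem_Ioo]; omega))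
  obtain ⟨y, rfl, k, hk⟩ := exists_grid_point (N := n ^ 2) (by positivity) x
  have h1 := norm_sepOp_sub_le hH hn he y (2 * Real.pi * k / (n ^ 2 : ℕ))
  have h2 := norm_le_norm_add_norm_sub (sepOp H n R e t ((2 * Real.pi * k / (n ^ 2 : ℕ) : ℝ) : Torus))
    (sepOp H n R e t (y : Torus))
  rw [norm_sub_rev] at h2
  have h3 : M * (n * |y - 2 * Real.pi * k / (n ^ 2 : ℕ)|) ≤ M * (2 * Real.pi / n) := by
    refine mul_le_mul_of_nonneg_left ?_ hM
    calc _ ≤ (n : ℝ) * (2 * Real.pi / (n ^ 2 : ℕ)) := by gcongr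
      _ = _ := by push_cast; field_simp
  linarith [ha k]

variable {Ω : Type*} [MeasurableSpace Ω] {P : Measure Ω} [IsProbabilityMeasure P]

/-- Uniform bound for the transformed noise. -/
theorem exists_event_norm_sepOp_noise_le {H : ℝ → ℝ} (hH : IsLowPassFilter H) {n : ℕ} (hn : 1 ≤ n)
    {t R V δ : ℝ} (hV : 0 < V) (hδ : 0 < δ) (hδ1 : δ < 1) {ε : ℝ → Ω → ℂ}
    (hmeas : ∀ s, Measurable (ε s)) (hsub : ∀ s, IsComplexSubGaussian (ε s) V P)
    (hind : iIndepFun (fun ℓ : {ℓ : ℤ // |ℓ| < (n : ℤ)} => ε (t - ((ℓ : ℤ) : ℝ) / R)) P) :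
    ∃ E : Set Ω, MeasurableSet E ∧ 1 - δ < P.real E ∧ ∀ ω ∈ E, ∀ x : Torus,
      ‖sepOp H n R (fun s => ε s ω) t x‖ ≤ 50 * V * Real.sqrt (Real.log (8 * n / δ) / n) := by
  have hn0 : (0 : ℝ) < n := by exact_mod_cast hn
  have hn1 : (1 : ℝ) ≤ n := by exact_mod_cast hn
  let T := {ℓ : ℤ // |ℓ| < (n : ℤ)}
  let _ : Fintype T := Fintype.subtype (Finset.Ioo (-(n : ℤ)) n) fun ℓ => mem_Ioo_iff_abs_lt
  have hcard : Fintype.card T ≤ 2 * n := by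
    have : Fintype.card T = (Finset.Ioo (-(n : ℤ)) n).card :=
      Fintype.subtype_card _ fun ℓ => mem_Ioo_iff_abs_lt
    rw [this, Int.card_Ioo]
    omega
  set Λ := Real.log (8 * n / δ) with hΛ
  have harg : 1 ≤ 8 * n / δ := by
    rw [le_div_iff₀ hδ]
    linarith
  have hΛ0 : 0 ≤ Λ := Real.log_nonneg harg
  let X : T → Ω → ℂ := fun ℓ => ε (t - ((ℓ : ℤ) : ℝ) / R)
  let c : Fin (n ^ 2) → T → ℂ := fun k ℓ => (hbar H n : ℂ) * (H (|((ℓ : ℤ) : ℝ)| / n) : ℂ)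
    * fourier (ℓ : ℤ) ((2 * Real.pi * k / (n ^ 2 : ℕ) : ℝ) : Torus)
  have hc : ∀ k ℓ, ‖c k ℓ‖ ≤ 1 / n := fun k ℓ => by
    simp only [c]
    rw [norm_mul, norm_mul, norm_fourier_apply, mul_one, Complex.norm_real, Complex.norm_real,
      Real.norm_of_nonneg (hH.nonneg _), Real.norm_of_nonneg (hH.hbar_pos hn).le]
    exact (mul_le_of_le_one_right (hH.hbar_pos hn).le (hH.le_one _)).trans (hH.hbar_le hn)
  -- One union bound for two families: the four real sums at each grid point, and the parts of each
  -- sample, which control the oscillation between grid points.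
  let Y : (Fin (n ^ 2) × Bool × Bool) ⊕ (T × Bool) → Ω → ℝ :=
    Sum.elim (fun i ω => ∑ ℓ, reIm i.2.1 (c i.1 ℓ) * reIm i.2.2 (X ℓ ω))
      (fun i ω => reIm i.2 (X i.1 ω))
  let v : (Fin (n ^ 2) × Bool × Bool) ⊕ (T × Bool) → NNReal :=
    Sum.elim (fun _ => (2 * V ^ 2 / n).toNNReal) (fun _ => (V ^ 2).toNNReal)
  -- With `q = 2Λ`, the squared factor `9` must dominate `8` for the grid sums and `4` for the
  -- samples.
  let τ : (Fin (n ^ 2) × Bool × Bool) ⊕ (T × Bool) → ℝ :=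
    Sum.elim (fun _ => 3 * V * Real.sqrt (Λ / n)) (fun _ => 3 * V * Real.sqrt Λ)
  obtain ⟨E, hE, hPE, hbound⟩ := exists_event_forall_abs_lt (P := P) (Y := Y) (c := v) (τ := τ)
    (q := 2 * Λ)
    (by
      rintro (i | i)
      · exact Finset.measurable_sum _ fun ℓ _ =>
          ((measurable_reIm _).comp (hmeas _)).const_mul _
      · exact (measurable_reIm _).comp (hmeas _))
    (by
      rintro (i | i)
      · exact Real.toNNReal_pos.2 (by positivity)
      · exact Real.toNNReal_pos.2 (by positivity))
    (by
      rintro (i | i)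
      · exact hasSubgaussianMGF_weighted_sum (X := X) (fun ℓ => hsub _) hind hn
          (fun ℓ => (abs_reIm_le_norm _ _).trans (hc _ ℓ)) hcard _
      · exact (hsub _).hasSubgaussianMGF _)
    (by
      rintro (i | i)
      · exact show 0 ≤ 3 * V * Real.sqrt (Λ / n) by positivity
      · exact show 0 ≤ 3 * V * Real.sqrt Λ by positivity)
    (by
      rintro (i | i)
      · change 2 * ((2 * V ^ 2 / n).toNNReal : ℝ) * (2 * Λ) ≤ (3 * V * Real.sqrt (Λ / n)) ^ 2
        rw [Real.coe_toNNReal _ (by positivity), mul_pow, Real.sq_sqrt (by positivity)]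
        have : 0 ≤ V ^ 2 * (Λ / n) := by positivity
        calc 2 * (2 * V ^ 2 / n) * (2 * Λ) = 8 * (V ^ 2 * (Λ / n)) := by ring
          _ ≤ 9 * (V ^ 2 * (Λ / n)) := by linarith
          _ = _ := by ring
      · change 2 * ((V ^ 2).toNNReal : ℝ) * (2 * Λ) ≤ (3 * V * Real.sqrt Λ) ^ 2
        rw [Real.coe_toNNReal _ (by positivity), mul_pow, Real.sq_sqrt (by positivity)]
        have : 0 ≤ V ^ 2 * Λ := by positivity
        linarith)
  refine ⟨E, hE, lt_of_lt_of_le ?_ hPE, fun ω hω x => ?_⟩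
  -- Each tail is at most `2(δ/8n)²` and there are at most `4n² + 4n ≤ 8n²` variables, so the
  -- failure probability is at most `δ²/4`.
  · have hexp : Real.exp (-(2 * Λ)) = (δ / (8 * n)) ^ 2 := by
      rw [show -(2 * Λ) = -Λ + -Λ by ring, Real.exp_add, Real.exp_neg, hΛ,
        Real.exp_log (by positivity), inv_div, sq]
    have hcard2 : (Fintype.card ((Fin (n ^ 2) × Bool × Bool) ⊕ (T × Bool)) : ℝ) ≤ 8 * n ^ 2 := by
      have : Fintype.card ((Fin (n ^ 2) × Bool × Bool) ⊕ (T × Bool)) ≤ 8 * n ^ 2 := by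
        simp only [Fintype.card_sum, Fintype.card_prod, Fintype.card_fin, Fintype.card_bool]
        nlinarith
      exact_mod_cast this
    have : (Fintype.card ((Fin (n ^ 2) × Bool × Bool) ⊕ (T × Bool)) : ℝ)
        * (2 * Real.exp (-(2 * Λ))) < δ := by
      rw [hexp]
      calc _ ≤ 8 * (n : ℝ) ^ 2 * (2 * (δ / (8 * n)) ^ 2) := by gcongr
        _ = δ ^ 2 / 4 := by field_simp; norm_num
        _ < δ := by nlinarith
    linarith
  · have hgrid : ∀ k : Fin (n ^ 2), ‖sepOp H n R (fun s => ε s ω) t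
        ((2 * Real.pi * k / (n ^ 2 : ℕ) : ℝ) : Torus)‖ ≤ 4 * (3 * V * Real.sqrt (Λ / n)) := by
      intro k
      have h := norm_sum_mul_le_of_reIm (c k) (fun ℓ => X ℓ ω)
        (fun b b' => (hbound ω hω (Sum.inl (k, b, b'))).le)
      refine le_trans (le_of_eq ?_) h
      unfold sepOp
      rw [Finset.mul_sum, Finset.sum_subtype _ (fun ℓ => mem_Ioo_iff_abs_lt)]
      congr 1
      refine Finset.sum_congr rfl fun ℓ _ => ?_
      simp only [c, X]
      ring
    have hsingle : ∀ ℓ ∈ Finset.Ioo (-(n : ℤ)) n,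
        ‖ε (t - (ℓ : ℝ) / R) ω‖ ≤ 2 * (3 * V * Real.sqrt Λ) := by
      intro ℓ hℓ
      rw [mem_Ioo_iff_abs_lt] at hℓ
      have h1 : |(ε (t - (ℓ : ℝ) / R) ω).re| < 3 * V * Real.sqrt Λ :=
        hbound ω hω (Sum.inr (⟨ℓ, hℓ⟩, true))
      have h2 : |(ε (t - (ℓ : ℝ) / R) ω).im| < 3 * V * Real.sqrt Λ :=
        hbound ω hω (Sum.inr (⟨ℓ, hℓ⟩, false))
      linarith [Complex.norm_le_abs_re_add_abs_im (ε (t - (ℓ : ℝ) / R) ω)]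
    refine (norm_sepOp_le_of_grid hH hn (e := fun s => ε s ω) hsingle hgrid x).trans ?_
    have hsqrt : Real.sqrt Λ / n ≤ Real.sqrt (Λ / n) := by
      rw [Real.sqrt_div hΛ0]
      refine div_le_div_of_nonneg_left (Real.sqrt_nonneg _) (Real.sqrt_pos.2 hn0) ?_
      exact (Real.sqrt_le_left hn0.le).2 (by nlinarith)
    have hVs : 0 ≤ V * Real.sqrt (Λ / n) := by positivity
    -- The constant `50` is `12 + 38`: four sums at threshold `3` on the grid, and `2·3·2π` for the
    -- oscillation.
    have hpi : 12 * Real.pi ≤ 38 := by linarith [Real.pi_lt_d2]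
    calc 4 * (3 * V * Real.sqrt (Λ / n)) + 2 * (3 * V * Real.sqrt Λ) * (2 * Real.pi / n)
        = 12 * (V * Real.sqrt (Λ / n)) + 12 * Real.pi * (V * (Real.sqrt Λ / n)) := by ring
      _ ≤ 12 * (V * Real.sqrt (Λ / n)) + 38 * (V * Real.sqrt (Λ / n)) := by gcongr
      _ = _ := by ring

end

section

/-! ### Clusters of the level set -/

theorem continuous_sepOp (H : ℝ → ℝ) (n : ℕ) (R : ℝ) (F : ℝ → ℂ) (t : ℝ) :
    Continuous (sepOp H n R F t) := by
  unfold sepOp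
  exact continuous_const.mul (continuous_finsetSum _ fun ℓ _ =>
    continuous_const.mul (fourier ℓ).continuous)

variable {K : ℕ}

theorem one_le_clusterConst (H : ℝ → ℝ) (S : ℕ) (A : Fin K → ℝ → ℂ) (φ : Fin K → ℝ → ℝ) (t : ℝ) :
    1 ≤ clusterConst H S A φ t := le_max_left _ _

theorem totalAmp_mul_locConst_le (H : ℝ → ℝ) {S : ℕ} (hS : 2 ≤ S) {A : Fin K → ℝ → ℂ}
    {φ : Fin K → ℝ → ℝ} {t : ℝ} (hm : 0 < minAmp A φ t) :
    16 * (totalAmp A t * locConst H S) ≤ minAmp A φ t * clusterConst H S A φ t ^ S := by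
  have hM := totalAmp_nonneg A t
  have hL := locConst_nonneg H S
  have ha : 0 ≤ 16 * totalAmp A t * locConst H S / minAmp A φ t := by positivity
  have h : 16 * totalAmp A t * locConst H S / minAmp A φ t ≤ clusterConst H S A φ t ^ S := by
    calc _ = ((16 * totalAmp A t * locConst H S / minAmp A φ t) ^ (1 / (S : ℝ))) ^ S := by
          rw [one_div, Real.rpow_inv_natCast_pow ha (by omega)]
      _ ≤ _ := by
          gcongr
          exact le_max_right _ _
  rw [div_le_iff₀ hm] at h
  linarith

/-- Distances are measured in units of `C/n`: `c = 1` serves points off all clusters, `c = 2` the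
other components near a given frequency. -/
theorem norm_sum_far_le {H : ℝ → ℝ} (hH : IsLowPassFilter H) {S : ℕ} (hS : 2 ≤ S) {n : ℕ}
    (hn : 1 ≤ n) {A : Fin K → ℝ → ℂ} {φ φ' : Fin K → ℝ → ℝ} {t R : ℝ} (hm : 0 < minAmp A φ t)
    {c : ℝ} (hc : 0 < c) (s : Finset (Fin K)) {x : Torus}
    (hfar : ∀ j ∈ s, c * clusterConst H S A φ t ≤ n * ‖x - redFreq φ' R t j‖) :
    ‖∑ j ∈ s, component A φ j t * filterKernel H n (x - redFreq φ' R t j)‖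
      ≤ minAmp A φ t / (16 * c ^ S) := by
  have hn0 : (0 : ℝ) < n := by exact_mod_cast hn
  have hL := locConst_nonneg H S
  have hC : 0 < clusterConst H S A φ t := zero_lt_one.trans_le (one_le_clusterConst H S A φ t)
  have hkey := totalAmp_mul_locConst_le H hS hm
  set C := clusterConst H S A φ t
  calc _ ≤ ∑ j ∈ s, ‖A j t‖ * (locConst H S / (c * C) ^ S) := by
        refine norm_sum_le_of_le _ fun j hj => ?_
        rw [norm_mul, norm_component]
        refine mul_le_mul_of_nonneg_left ?_ (norm_nonneg _)
        have hj' := hfar j hj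
        have hpos : 0 < ‖x - redFreq φ' R t j‖ :=
          pos_of_mul_pos_right ((mul_pos hc hC).trans_le hj') hn0.le
        refine (hH.norm_filterKernel_le hn hS hpos).trans ?_
        gcongr
    _ ≤ ∑ j, ‖A j t‖ * (locConst H S / (c * C) ^ S) :=
        Finset.sum_le_sum_of_subset_of_nonneg (Finset.subset_univ _) fun j _ _ => by positivity
    _ = totalAmp A t * locConst H S / (c ^ S * C ^ S) := by
        rw [← Finset.sum_mul, ← totalAmp, mul_pow]
        ring
    _ ≤ _ := by
        rw [div_le_div_iff₀ (by positivity) (by positivity)]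
        have : 0 < c ^ S := by positivity
        nlinarith

/-- A pair `j ≠ k` makes the separation finite, and `4C/0 = ∞` makes it nonzero, so the extended
hypothesis becomes a real inequality. -/
theorem clusterConst_le_mul_edist {H : ℝ → ℝ} {S n : ℕ} {A : Fin K → ℝ → ℂ}
    {φ φ' : Fin K → ℝ → ℝ} {t R : ℝ}
    (hsep : ENNReal.ofReal (4 * clusterConst H S A φ t) / minSep φ' R t ≤ (n : ENNReal))
    {j k : Fin K} (hjk : j ≠ k) :
    ∃ η : ℝ, minSep φ' R t = ENNReal.ofReal η ∧ 4 * clusterConst H S A φ t ≤ n * η ∧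
      η ≤ dist (redFreq φ' R t j) (redFreq φ' R t k) := by
  have hC : 0 < 4 * clusterConst H S A φ t := by
    linarith [one_le_clusterConst H S A φ t]
  have hle : minSep φ' R t ≤ edist (redFreq φ' R t j) (redFreq φ' R t k) :=
    iInf_le_of_le j (iInf_le_of_le k (iInf_le _ hjk))
  have htop : minSep φ' R t ≠ ⊤ := ne_top_of_le_ne_top (edist_ne_top _ _) hle
  have h0 : minSep φ' R t ≠ 0 := by
    intro h
    rw [h, ENNReal.div_zero (by simpa using hC)] at hsep
    exact absurd hsep (by simp)
  refine ⟨(minSep φ' R t).toReal, (ENNReal.ofReal_toReal htop).symm, ?_, ?_⟩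
  · rw [ENNReal.div_le_iff h0 htop] at hsep
    have := ENNReal.toReal_mono (ENNReal.mul_ne_top (by simp) htop) hsep
    rwa [ENNReal.toReal_ofReal hC.le, ENNReal.toReal_mul, ENNReal.toReal_natCast] at this
  · rw [edist_dist] at hle
    exact ENNReal.toReal_le_of_le_ofReal dist_nonneg hle

theorem exists_clusters {H : ℝ → ℝ} (hH : IsLowPassFilter H) {S : ℕ} (hS : 2 ≤ S) {n : ℕ}
    (hn : 1 ≤ n) {A : Fin K → ℝ → ℂ} {φ φ' : Fin K → ℝ → ℝ} {t R : ℝ} (hR : 0 < R)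
    (hm : 0 < minAmp A φ t)
    (hsep : ENNReal.ofReal (4 * clusterConst H S A φ t) / minSep φ' R t ≤ (n : ENNReal))
    {F : ℝ → ℂ}
    (happrox : ∀ x, ‖sepOp H n R F t x
        - ∑ j, component A φ j t * filterKernel H n (x - redFreq φ' R t j)‖
      ≤ 3 * minAmp A φ t / 16) :
    ∃ G : Fin K → Set Torus,
      levelSet H n R F t (3 * minAmp A φ t / 4) = (⋃ ℓ, G ℓ) ∧
      (∀ ℓ k, ℓ ≠ k → Disjoint (G ℓ) (G k)) ∧
      (∀ ℓ, Metric.diam (G ℓ) ≤ 2 * clusterConst H S A φ t / n) ∧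
      (∀ ℓ k, ℓ ≠ k → ∀ x ∈ G ℓ, ∀ y ∈ G k, minSep φ' R t / 2 ≤ edist x y) ∧
      (∀ ℓ, Metric.closedBall (redFreq φ' R t ℓ) (1 / (4 * n)) ⊆ G ℓ) ∧
      (∀ ℓ, ∃ x ∈ G ℓ, IsMaxOn (fun y => ‖sepOp H n R F t y‖) (G ℓ) x) ∧
      (∀ ℓ, ∀ x ∈ G ℓ, IsMaxOn (fun y => ‖sepOp H n R F t y‖) (G ℓ) x →
        dist x (redFreq φ' R t ℓ) ≤ 2 * clusterConst H S A φ t / n ∧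
        ∃ r : ℝ, (r : Torus) = x ∧
          |R * r - φ' ℓ t| ≤ R * (2 * clusterConst H S A φ t / n)) := by
  have hn0 : (0 : ℝ) < n := by exact_mod_cast hn
  have hC1 := one_le_clusterConst H S A φ t
  set C := clusterConst H S A φ t with hC
  set m := minAmp A φ t with hmdef
  set Λ := redFreq φ' R t with hΛ
  have hCn : 0 ≤ C / n := by positivity
  let G : Fin K → Set Torus := fun ℓ =>
    levelSet H n R F t (3 * m / 4) ∩ Metric.closedBall (Λ ℓ) (C / n)
  have hball : ∀ ℓ, Metric.closedBall (Λ ℓ) (1 / (4 * n)) ⊆ G ℓ := by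
    intro ℓ x hx
    rw [Metric.mem_closedBall] at hx
    have hsmall : (1 : ℝ) / (4 * n) ≤ C / n := by
      rw [div_le_div_iff₀ (by positivity) hn0]
      nlinarith
    refine ⟨?_, Metric.mem_closedBall.2 (hx.trans hsmall)⟩
    change 3 * m / 4 ≤ ‖sepOp H n R F t x‖
    -- Here `c = 2` works because `4C - 1/4 ≥ 2C`, as `C ≥ 1`.
    have hfar : ‖∑ j ∈ Finset.univ.erase ℓ, component A φ j t * filterKernel H n (x - Λ j)‖
        ≤ m / (16 * 2 ^ S) := by
      refine norm_sum_far_le hH hS hn hm two_pos _ fun j hj => ?_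
      obtain ⟨η, -, h1, h2⟩ := clusterConst_le_mul_edist hsep (Finset.ne_of_mem_erase hj)
      have h3 : dist (Λ j) (Λ ℓ) ≤ dist x (Λ j) + dist x (Λ ℓ) := dist_triangle_left _ _ _
      rw [← dist_eq_norm]
      have h4 : n * dist x (Λ ℓ) ≤ 1 / 4 := by
        rw [le_div_iff₀ (by positivity)] at hx
        linarith
      have h5 := mul_le_mul_of_nonneg_left (h2.trans h3) hn0.le
      linarith
    have hfar' : m / (16 * 2 ^ S) ≤ m / 64 := by
      have : (2 : ℝ) ^ 2 ≤ 2 ^ S := pow_le_pow_right₀ one_le_two hS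
      refine div_le_div_of_nonneg_left hm.le (by norm_num) ?_
      linarith
    have hnear : 31 / 32 * m ≤ ‖component A φ ℓ t * filterKernel H n (x - Λ ℓ)‖ := by
      rw [norm_mul, mul_comm]
      exact mul_le_mul (minAmp_le A φ t ℓ)
        (hH.le_norm_filterKernel hn (by rwa [← dist_eq_norm])) (by norm_num) (norm_nonneg _)
    have hap := happrox x
    rw [← Finset.add_sum_erase _ _ (Finset.mem_univ ℓ)] at hap
    set a := component A φ ℓ t * filterKernel H n (x - Λ ℓ)
    set b := ∑ j ∈ Finset.univ.erase ℓ, component A φ j t * filterKernel H n (x - Λ j)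
    have h1 : ‖a‖ ≤ ‖sepOp H n R F t x‖ + ‖sepOp H n R F t x - (a + b)‖ + ‖b‖ := by
      calc ‖a‖ = ‖sepOp H n R F t x - (sepOp H n R F t x - (a + b)) - b‖ := by
            congr 1
            ring
        _ ≤ _ := (norm_sub_le _ _).trans (add_le_add_left (norm_sub_le _ _) _)
    linarith
  have hsepG : ∀ ℓ k, ℓ ≠ k → ∀ x ∈ G ℓ, ∀ y ∈ G k,
      minSep φ' R t / 2 ≤ edist x y ∧ 0 < dist x y := by
    intro ℓ k hℓk x hx y hy
    obtain ⟨η, hη, h1, h2⟩ := clusterConst_le_mul_edist hsep hℓk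
    have hx' := Metric.mem_closedBall.1 hx.2
    have hy' := Metric.mem_closedBall.1 hy.2
    have h3 : dist (Λ ℓ) (Λ k) ≤ dist x (Λ ℓ) + dist x y + dist y (Λ k) := by
      have := dist_triangle4 (Λ ℓ) x y (Λ k)
      rwa [dist_comm (Λ ℓ) x] at this
    have h4 : 4 * (C / n) ≤ η := by
      rw [mul_div_assoc', div_le_iff₀ hn0]
      linarith
    -- The centres are `η` apart and each radius is `C/n ≤ η/4`.
    have h5 : η / 2 ≤ dist x y := by linarith
    have h6 : 0 < C / n := by positivity
    refine ⟨?_, by linarith⟩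
    rw [hη, edist_dist, ENNReal.div_le_iff (by norm_num) (by norm_num),
      show (2 : ENNReal) = ENNReal.ofReal 2 by simp, ← ENNReal.ofReal_mul dist_nonneg]
    exact ENNReal.ofReal_le_ofReal (by linarith)
  have : Fact (0 < 2 * Real.pi) := ⟨Real.two_pi_pos⟩
  have hcompact : ∀ ℓ, IsCompact (G ℓ) := fun ℓ =>
    (isClosed_le continuous_const (continuous_sepOp H n R F t).norm).isCompact.inter_right
      Metric.isClosed_closedBall
  refine ⟨G, ?_, ?_, ?_, fun ℓ k h x hx y hy => (hsepG ℓ k h x hx y hy).1, hball, ?_, ?_⟩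
  · refine Set.Subset.antisymm (fun x hx => ?_) (Set.iUnion_subset fun ℓ => Set.inter_subset_left)
    by_contra hcon
    have hfar : ∀ j ∈ (Finset.univ : Finset (Fin K)), 1 * C ≤ n * ‖x - Λ j‖ := by
      intro j _
      by_contra h
      refine hcon (Set.mem_iUnion.2 ⟨j, hx, ?_⟩)
      rw [Metric.mem_closedBall, dist_eq_norm, le_div_iff₀ hn0]
      linarith [not_le.1 h]
    have h1 := norm_sum_far_le hH hS hn hm one_pos _ hfar
    rw [one_pow, mul_one] at h1
    have h2 := happrox x
    have h3 := norm_le_norm_add_norm_sub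
      (∑ j, component A φ j t * filterKernel H n (x - Λ j)) (sepOp H n R F t x)
    rw [norm_sub_rev] at h3
    have hx' : 3 * m / 4 ≤ ‖sepOp H n R F t x‖ := hx
    linarith
  · intro ℓ k hℓk
    refine Set.disjoint_left.2 fun x hx hy => ?_
    exact absurd (hsepG ℓ k hℓk x hx x hy).2 (by simp)
  · intro ℓ
    refine (Metric.diam_mono Set.inter_subset_right Metric.isBounded_closedBall).trans ?_
    refine (Metric.diam_closedBall hCn).trans (le_of_eq ?_)
    ring
  · intro ℓ
    refine (hcompact ℓ).exists_isMaxOn ⟨Λ ℓ, hball ℓ (Metric.mem_closedBall_self (by positivity))⟩ ?_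
    exact (continuous_sepOp H n R F t).norm.continuousOn
  · intro ℓ x hx _
    have hd : dist x (Λ ℓ) ≤ 2 * C / n := by
      have := Metric.mem_closedBall.1 hx.2
      rw [mul_div_assoc]
      linarith
    refine ⟨hd, ?_⟩
    obtain ⟨y, hy, hyn⟩ := exists_coe_eq_abs_eq_norm (x - Λ ℓ)
    -- The representative nearest to `φ'_ℓ(t)/R`, so the circle distance becomes a real one.
    refine ⟨φ' ℓ t / R + y, ?_, ?_⟩
    · rw [AddCircle.coe_add, hy]
      exact add_sub_cancel (Λ ℓ) x
    · have : R * (φ' ℓ t / R + y) - φ' ℓ t = R * y := by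
        field_simp
        ring
      rw [this, abs_mul, abs_of_pos hR, hyn, ← dist_eq_norm]
      gcongr

end

end SSO

/-! ### Assembly; the constants turn out to be absolute. -/

theorem theorem4p3p1 (H : ℝ → ℝ) (hH : SSO.IsLowPassFilter H) :
    ∃ C₁ C₂ C₃ : ℝ, 1 ≤ C₁ ∧ 0 < C₂ ∧ 0 < C₃ ∧
      ∀ (S : ℕ) (_ : 2 ≤ S)
        (Ω : Type*) [MeasurableSpace Ω]
        (P : MeasureTheory.Measure Ω) [MeasureTheory.IsProbabilityMeasure P]
        (K : ℕ) (_ : 1 ≤ K)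
        (t α Δ R V δ : ℝ) (_ : 0 < α) (_ : 0 < Δ) (_ : 0 < R) (_ : 0 ≤ V) (_ : 0 < δ) (_ : δ < 1)
        (n : ℕ) (_ : n = ⌊R * Δ⌋₊)
        -- the components of the signal near `t`
        (A : Fin K → ℝ → ℂ) (φ φ' : Fin K → ℝ → ℝ)
        (_ : ∀ j, ContinuousOn (A j) (Set.Icc (t - Δ) (t + Δ)))
        (_ : ∀ j, ∀ s ∈ Set.Icc (t - Δ) (t + Δ),
          HasDerivWithinAt (φ j) (φ' j s) (Set.Icc (t - Δ) (t + Δ)) s)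
        (_ : ∀ j, ContinuousOn (φ' j) (Set.Icc (t - Δ) (t + Δ)))
        (_ : 0 < SSO.minAmp A φ t)
        -- slow variation
        (_ : ∀ j, ∀ u : ℝ, |u| ≤ Δ → ‖A j (t + u) - A j t‖ ≤ α * |u| * ‖A j t‖)
        (_ : ∀ j, ∀ u : ℝ, |u| ≤ Δ → |φ' j (t + u) - φ' j t| ≤ α * |u| * |φ' j t|)
        -- the noise, independent at the sampling points
        (ε : ℝ → Ω → ℂ) (_ : ∀ s, Measurable (ε s))
        (_ : ∀ s, SSO.IsComplexSubGaussian (ε s) V P)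
        (_ : ProbabilityTheory.iIndepFun
          (fun ℓ : {ℓ : ℤ // |ℓ| < (n : ℤ)} => ε (t - ((ℓ : ℤ) : ℝ) / R)) P)
        -- the conditions on `n` and `Δ`
        (_ : C₁ ≤ (n : ℝ))
        (_ : C₂ * V * Real.sqrt (Real.log (C₃ * n / δ) / n) ≤ SSO.minAmp A φ t / 16)
        (_ : ENNReal.ofReal (4 * SSO.clusterConst H S A φ t) / SSO.minSep φ' R t ≤ (n : ENNReal))
        (_ : α * SSO.totalAmp A t * (SSO.maxFreq φ' t * Δ + 1) * Δ ≤ SSO.minAmp A φ t / 4),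
        ∃ E : Set Ω, MeasurableSet E ∧ 1 - δ < P.real E ∧
          ∀ ω ∈ E,
            ∃ G : Fin K → Set SSO.Torus,
              -- disjoint union
              SSO.levelSet H n R (SSO.noisySignal A φ (fun s => ε s ω)) t
                  (3 * SSO.minAmp A φ t / 4) = (⋃ ℓ, G ℓ) ∧
              (∀ ℓ k, ℓ ≠ k → Disjoint (G ℓ) (G k)) ∧
              -- diameter
              (∀ ℓ, Metric.diam (G ℓ) ≤ 2 * SSO.clusterConst H S A φ t / n) ∧
              -- separation
              (∀ ℓ k, ℓ ≠ k → ∀ x ∈ G ℓ, ∀ y ∈ G k, SSO.minSep φ' R t / 2 ≤ edist x y) ∧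
              -- interval inclusion
              (∀ ℓ, Metric.closedBall (SSO.redFreq φ' R t ℓ) (1 / (4 * n)) ⊆ G ℓ) ∧
              -- a maximizer exists in each cluster
              (∀ ℓ, ∃ x ∈ G ℓ, IsMaxOn
                (fun y => ‖SSO.sepOp H n R (SSO.noisySignal A φ (fun s => ε s ω)) t y‖) (G ℓ) x) ∧
              -- and every maximizer estimates the frequency, also after multiplication by `R`
              (∀ ℓ, ∀ x ∈ G ℓ, IsMaxOn
                (fun y => ‖SSO.sepOp H n R (SSO.noisySignal A φ (fun s => ε s ω)) t y‖) (G ℓ) x →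
                dist x (SSO.redFreq φ' R t ℓ) ≤ 2 * SSO.clusterConst H S A φ t / n ∧
                ∃ r : ℝ, (r : SSO.Torus) = x ∧
                  |R * r - φ' ℓ t| ≤ R * (2 * SSO.clusterConst H S A φ t / n)) := by
  refine ⟨1, 50, 8, le_rfl, by norm_num, by norm_num, ?_⟩
  intro S hS Ω _ P _ K hK t α Δ R V δ hα hΔ hR hV hδ hδ1 n hn A φ φ' _ hd _ hm hA hφ ε hmeas hsub
    hind hn1 hnoise hsep hlin
  have hn1' : 1 ≤ n := by exact_mod_cast hn1
  have hnR : (n : ℝ) ≤ R * Δ := hn ▸ Nat.floor_le (by positivity)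
  -- The tail bound needs a positive parameter. For `V = 0` the noise is also in `𝒢(V')` for small
  -- `V' > 0`, chosen to keep the noise condition.
  obtain ⟨V', hV', hVV', hnoise'⟩ : ∃ V' : ℝ, 0 < V' ∧ V ≤ V' ∧
      50 * V' * Real.sqrt (Real.log (8 * n / δ) / n) ≤ SSO.minAmp A φ t / 16 := by
    rcases hV.eq_or_lt with rfl | hV
    · set r := Real.sqrt (Real.log (8 * n / δ) / n)
      have hr : 0 ≤ r := Real.sqrt_nonneg _
      refine ⟨SSO.minAmp A φ t / (800 * (r + 1)), by positivity, by positivity, ?_⟩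
      rw [mul_div_assoc', div_mul_eq_mul_div, div_le_div_iff₀ (by positivity) (by norm_num)]
      nlinarith
    · exact ⟨V, hV, le_rfl, hnoise⟩
  obtain ⟨E, hE, hPE, hbound⟩ := SSO.exists_event_norm_sepOp_noise_le hH hn1' hV' hδ hδ1 hmeas
    (fun s => (hsub s).mono hV hVV') hind
  refine ⟨E, hE, hPE, fun ω hω => ?_⟩
  refine SSO.exists_clusters hH hS hn1' hR hm hsep fun x => ?_
  have h1 := SSO.norm_sepOp_noisySignal_sub_le hH hn1' hα.le hR hnR hd hA hφ (fun s => ε s ω) x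
  have h2 := (hbound ω hω x).trans hnoise'
  have h3 := norm_le_norm_add_norm_sub'
    (SSO.sepOp H n R (SSO.noisySignal A φ (fun s => ε s ω)) t x
      - ∑ j, SSO.component A φ j t * SSO.filterKernel H n (x - SSO.redFreq φ' R t j))
    (SSO.sepOp H n R (fun s => ε s ω) t x)
  -- `𝔪/8` from linearization plus `𝔪/16` from noise.
  linarith
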